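/- Let $B=\{x\in\mathbb R^2:|x|<R\}$ with $R>0$, let $0<2\theta<1$ and $2(1-\theta)\le q<2$. For $v\in W^{1,q}(B)$ put $$\mathcal F(v)=\int_B\frac{|\nabla v|^2}{(1+|v|)^{2\theta}}\,dx\in[0,+\infty],$$ and for $1<p<\infty$ let $$\lambda^{\theta,p}(B)=\inf\Big\{\mathcal F(v): v\in W^{1,q}(B),\ v\neq 0,\ \int_B v\,dx=0,\ \|v\|_{L^p(B)}=1\Big\}.$$ Let $\lambda^{\theta,p}_{as}(B)$ be the infimum of $\mathcal F(v)$ over those $v$ in the same class which in addition satisfy $v(x_1,-x_2)=-v(x_1,x_2)$ for almost every $(x_1,x_2)\in B$. Then there is $p_0>1$ (depending on $R,\theta,q$) such that for every $p>p_0$ $$\lambda^{\theta,p}(B)<\lambda^{\theta,p}_{as}(B).$$ Moreover, for every $p>p_0$, no minimizer $u$ for $\lambda^{\theta,p}(B)$ is anti-symmetric with respect to a line through the origin; that is, for no line $\ell$ through the origin, with reflection $\sigma_\ell$, does $u(\sigma_\ell x)=-u(x)$ hold for almost every $x\in B$. -/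

import Mathlib

open MeasureTheory Filter Topology
open scoped ENNReal ContDiff

/-- The Euclidean plane `ℝ²`. -/
abbrev Plane : Type := EuclideanSpace ℝ (Fin 2)

/-- `G` is a weak (distributional) gradient of `v` on the open set `Ω`: both are locally
integrable on `Ω` and `∫_Ω v ∂_w φ = - ∫_Ω (G · w) φ` for every test function
`φ ∈ C_c^∞(Ω)` and every direction `w`. -/
structure IsWeakGradient (Ω : Set Plane) (v : Plane → ℝ) (G : Plane → Plane) : Prop where
  locallyIntegrableOn_fun : LocallyIntegrableOn v Ω volume
  locallyIntegrableOn_grad : LocallyIntegrableOn G Ω volume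
  integral_eq : ∀ φ : Plane → ℝ, ContDiff ℝ ∞ φ → HasCompactSupport φ → tsupport φ ⊆ Ω →
    ∀ w : Plane, ∫ x in Ω, v x * fderiv ℝ φ x w = - ∫ x in Ω, inner ℝ (G x) w * φ x

/-- Weak gradients are unique up to equality almost everywhere, so that `weakGrad` below does not
depend on the choice made in its definition. -/
theorem IsWeakGradient.ae_eq {Ω : Set Plane} (hΩ : IsOpen Ω) {v : Plane → ℝ}
    {G₁ G₂ : Plane → Plane} (h₁ : IsWeakGradient Ω v G₁) (h₂ : IsWeakGradient Ω v G₂) :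
    G₁ =ᵐ[volume.restrict Ω] G₂ := by
  have hG : LocallyIntegrableOn (fun x => G₁ x - G₂ x) Ω volume :=
    h₁.locallyIntegrableOn_grad.sub h₂.locallyIntegrableOn_grad
  have key : ∀ᵐ x ∂volume, x ∈ Ω → G₁ x - G₂ x = 0 := by
    refine hΩ.ae_eq_zero_of_integral_contDiff_smul_eq_zero hG ?_
    intro φ hφ hc hs
    have hint : ∀ G : Plane → Plane, LocallyIntegrableOn G Ω volume →
        Integrable (fun x => φ x • G x) volume := by
      intro G hGl
      have hK : IntegrableOn G (tsupport φ) volume :=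
        hGl.integrableOn_compact_subset hs hc.isCompact
      have h1 : IntegrableOn (fun x => φ x • G x) (tsupport φ) volume :=
        hK.continuousOn_smul hφ.continuous.continuousOn hc.isCompact
      refine (integrableOn_iff_integrable_of_support_subset ?_).1 h1
      intro x hx
      refine subset_tsupport φ ?_
      intro h0
      exact hx (by simp [h0])
    have hi₁ := hint G₁ h₁.locallyIntegrableOn_grad
    have hi₂ := hint G₂ h₂.locallyIntegrableOn_grad
    have hset : ∀ G : Plane → Plane, ∀ w : Plane,
        ∫ x in Ω, inner ℝ (G x) w * φ x = ∫ x, inner ℝ w (φ x • G x) := by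
      intro G w
      rw [setIntegral_eq_integral_of_forall_compl_eq_zero]
      · refine integral_congr_ae (Eventually.of_forall fun x => ?_)
        simp only [inner_smul_right, real_inner_comm w (G x)]
        ring
      · intro x hx
        have : φ x = 0 := image_eq_zero_of_notMem_tsupport fun h => hx (hs h)
        simp [this]
    have hsub : ∫ x, φ x • (G₁ x - G₂ x) = (∫ x, φ x • G₁ x) - ∫ x, φ x • G₂ x := by
      rw [← integral_sub hi₁ hi₂]
      simp only [smul_sub]
    rw [hsub, sub_eq_zero]
    refine ext_inner_left ℝ fun w => ?_
    rw [← integral_inner hi₁ w, ← integral_inner hi₂ w, ← hset, ← hset]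
    have e₁ := h₁.integral_eq φ hφ hc hs w
    have e₂ := h₂.integral_eq φ hφ hc hs w
    linarith
  refine (ae_restrict_iff' hΩ.measurableSet).2 ?_
  filter_upwards [key] with x hx hxΩ
  exact sub_eq_zero.1 (hx hxΩ)

open Classical in
/-- The weak gradient `∇v` of `v` on `Ω` (and `0` if `v` is not weakly differentiable). -/
noncomputable def weakGrad (Ω : Set Plane) (v : Plane → ℝ) : Plane → Plane :=
  if h : ∃ G, IsWeakGradient Ω v G then h.choose else 0

/-- Membership in the Sobolev space `W^{1,q}(Ω)`. -/
def MemW1 (Ω : Set Plane) (q : ℝ) (v : Plane → ℝ) : Prop :=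
  MemLp v (ENNReal.ofReal q) (volume.restrict Ω) ∧
    (∃ G, IsWeakGradient Ω v G) ∧
    MemLp (weakGrad Ω v) (ENNReal.ofReal q) (volume.restrict Ω)

/-- The energy `∫_Ω |∇v|² / (1 + |v|)^{2θ} dx ∈ [0, ∞]`. It may be infinite on `W^{1,q}(Ω)`,
as `q < 2`. -/
noncomputable def energy (Ω : Set Plane) (θ : ℝ) (v : Plane → ℝ) : ℝ≥0∞ :=
  ∫⁻ x in Ω, ENNReal.ofReal (‖weakGrad Ω v x‖ ^ 2 / (1 + |v x|) ^ (2 * θ))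

/-- The constraints: `v ∈ W^{1,q}(Ω)`, `v ≠ 0`, `∫_Ω v = 0`, `‖v‖_{L^p(Ω)} = 1`. -/
structure Admissible (Ω : Set Plane) (q p : ℝ) (v : Plane → ℝ) : Prop where
  memW1 : MemW1 Ω q v
  ne_zero : ¬ v =ᵐ[volume.restrict Ω] 0
  integral_eq_zero : ∫ x in Ω, v x = 0
  eLpNorm_eq_one : eLpNorm v (ENNReal.ofReal p) (volume.restrict Ω) = 1

/-- `v` is anti-symmetric on `Ω` with respect to the line through the origin orthogonal
to `e`: it changes sign under the reflection in that line. -/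
def IsAntisymmetric (Ω : Set Plane) (e : Plane) (v : Plane → ℝ) : Prop :=
  ∀ᵐ x ∂volume.restrict Ω, v ((Submodule.span ℝ {e})ᗮ.reflection x) = - v x

/-- The unit vector `e₂ = (0, 1)`, normal to the line `{x₂ = 0}`. -/
noncomputable def e₂ : Plane := EuclideanSpace.single 1 1

/-- The reflection used for `e₂` is `(x₁, x₂) ↦ (x₁, -x₂)`. -/
theorem reflection_e₂ (x : Plane) :
    (Submodule.span ℝ {e₂})ᗮ.reflection x = !₂[x 0, -x 1] := by
  rw [Submodule.reflection_orthogonal_apply, Submodule.reflection_singleton_apply]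
  ext i
  fin_cases i <;> simp [e₂, EuclideanSpace.inner_single_left] <;> ring

/-- `λ^{θ,p}(Ω)`, the infimum of the energy over all admissible functions. -/
noncomputable def lam (Ω : Set Plane) (θ q p : ℝ) : ℝ≥0∞ :=
  sInf {E | ∃ v, Admissible Ω q p v ∧ E = energy Ω θ v}

/-- `λ_as^{θ,p}(Ω)`, the infimum over the admissible functions that satisfy
`v(x₁, -x₂) = -v(x₁, x₂)`. -/
noncomputable def lamAs (Ω : Set Plane) (θ q p : ℝ) : ℝ≥0∞ :=
  sInf {E | ∃ v, Admissible Ω q p v ∧ IsAntisymmetric Ω e₂ v ∧ E = energy Ω θ v}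

/-- `u` is a minimizer for `λ^{θ,p}(Ω)`. -/
def IsMinimizer (Ω : Set Plane) (θ q p : ℝ) (u : Plane → ℝ) : Prop :=
  Admissible Ω q p u ∧ energy Ω θ u = lam Ω θ q p

/-!
Write `B` for the disk and `E(v)` for the energy of `v`.

Let `v` be an admissible function that is antisymmetric with respect to some line through the
origin. Its positive part carries exactly half of the energy and half of `∫ |v|^p`, so its `L^p` norm
is about `2^{-1/p}`, which tends to `1`. Subtracting the mean `m` of `v⁺` and normalising therefore
gives an admissible competitor whose energy is at most `E(v) / 2` times a factor close to `1`, as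
soon as `p` is large and `m` is small (`IsAntisymmetric.lam_le`). Hence `λ ≤ (3/4) E(v)`; this gives
the strict inequality and excludes antisymmetric minimizers, provided that three facts are known.

* The mean `m` is small when `E(v)` is small (`exists_forall_mean_posPart_le`).
* The energy of antisymmetric admissible functions is bounded away from zero for each fixed `p`
  (`exists_pos_le_energy_of_isAntisymmetric`).
* The antisymmetric infimum tends to zero as `p → ∞` (`exists_forall_lamAs_lt`). Points have zero
  capacity in the plane, so there is a bounded antisymmetric function with value at least `1/2`
  somewhere and arbitrarily small Dirichlet integral, and its `L^p` norm stays above `1/4` for large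
  `p`.

The first two facts follow from one estimate, `exists_eLpNorm_le_energy`. As `2 θ ≤ 1`, the function
`w = v / (1 + v²)^{1/4}` satisfies `∫ |∇w|² ≤ 2 E(v)` and `|v| ≤ 2 |w| + 2 w²`, and `w` has mean zero
when `v` is antisymmetric. The Sobolev inequality `‖w‖_r ≤ C ‖∇w‖_2` on `B`, for all finite `r`, then
bounds every `L^p` norm of `v` by its energy.

The Sobolev inequality is obtained from the pointwise bound of `∫_B |w(y) - w(x)| dy` by the Riesz
potential `∫_B |∇w(z)| / |z - x| dz`, which for smooth functions comes from integrating along the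
segments from `x`, and from the mapping properties of that potential
(`lintegral_riesz_rpow_le`). Mollification carries the pointwise bound over to weakly differentiable
functions and also gives the chain rule for weak gradients.
-/

/-! ### The kernel `1 / |x - z|` on a disk -/

/-- Negative powers of the norm above the critical exponent `-2` are integrable on disks of the
plane, with the explicit value given by polar coordinates. -/
theorem lintegral_ball_enorm_rpow_neg {b ρ : ℝ} (hb : b < 2) (hρ : 0 < ρ) :
    ∫⁻ y in Metric.ball (0 : Plane) ρ, ‖y‖ₑ ^ (-b) =
      ENNReal.ofReal (2 * (volume.real (Metric.ball (0 : Plane) 1) * (ρ ^ (2 - b) / (2 - b)))) := by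
  have hint : IntegrableOn (fun y : Plane => ‖y‖ ^ (-b)) (Metric.ball 0 ρ) volume := by
    refine integrableOn_ball_of_norm_le_rpow (C := 1) (α := b) (by simp) (by simpa using hb) ?_ ?_
    · refine Eventually.of_forall fun x => ?_
      rw [one_mul, Real.norm_of_nonneg (by positivity)]
    · exact (measurable_norm.pow_const _).aestronglyMeasurable
  have h0 : ∀ᵐ y : Plane ∂volume.restrict (Metric.ball 0 ρ),
      ‖y‖ₑ ^ (-b) = ENNReal.ofReal (‖y‖ ^ (-b)) := by
    refine ae_restrict_of_ae ?_
    filter_upwards [Measure.ae_ne volume (0 : Plane)] with y hy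
    rw [← ENNReal.ofReal_rpow_of_pos (norm_pos_iff.2 hy), ofReal_norm]
  rw [lintegral_congr_ae h0, ← ofReal_integral_eq_lintegral_ofReal hint
    (Eventually.of_forall fun y => by positivity)]
  congr 1
  have h1 : ∫ y in Metric.ball (0 : Plane) ρ, ‖y‖ ^ (-b) =
      ∫ y : Plane, (Set.Iio ρ).indicator (fun t : ℝ => t ^ (-b)) ‖y‖ := by
    rw [← integral_indicator measurableSet_ball]
    refine integral_congr_ae (Eventually.of_forall fun y => ?_)
    simp [Set.indicator]
  rw [h1, integral_fun_norm_addHaar volume (fun t => (Set.Iio ρ).indicator (fun t : ℝ => t ^ (-b)) t)]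
  have h2 : ∫ y in Set.Ioi (0 : ℝ), y ^ (Module.finrank ℝ Plane - 1) •
      (Set.Iio ρ).indicator (fun t : ℝ => t ^ (-b)) y = ρ ^ (2 - b) / (2 - b) := by
    have h3 : ∀ y ∈ Set.Ioi (0 : ℝ), y ^ (Module.finrank ℝ Plane - 1) •
      (Set.Iio ρ).indicator (fun t : ℝ => t ^ (-b)) y =
        (Set.Iio ρ).indicator (fun t : ℝ => t ^ (1 - b)) y := by
      intro y hy
      by_cases hyr : y < ρ
      · simp only [finrank_euclideanSpace, Fintype.card_fin, Set.indicator, Set.mem_Iio, hyr,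
          if_true, smul_eq_mul]
        rw [sub_eq_add_neg, Real.rpow_add hy]
        simp
      · simp [hyr]
    rw [setIntegral_congr_fun measurableSet_Ioi h3, setIntegral_indicator measurableSet_Iio,
      Set.Ioi_inter_Iio, ← integral_Ioc_eq_integral_Ioo, ← intervalIntegral.integral_of_le hρ.le,
      integral_rpow (Or.inl (by linarith))]
    rw [show 1 - b + 1 = 2 - b by ring, Real.zero_rpow (by linarith), sub_zero]
  rw [h2]
  simp

/-- The kernel integrals over a disk are bounded uniformly in the base point of the disk. -/
theorem setLIntegral_enorm_sub_rpow_neg_le {b R : ℝ} {x : Plane}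
    (hx : x ∈ Metric.ball (0 : Plane) R) :
    ∫⁻ z in Metric.ball (0 : Plane) R, ‖z - x‖ₑ ^ (-b) ≤
      ∫⁻ y in Metric.ball (0 : Plane) (2 * R), ‖y‖ₑ ^ (-b) := by
  rw [← lintegral_indicator measurableSet_ball, ← lintegral_indicator measurableSet_ball]
  calc _ ≤ ∫⁻ z : Plane, (Metric.ball (0 : Plane) (2 * R)).indicator
        (fun y => ‖y‖ₑ ^ (-b)) (z - x) := by
        refine lintegral_mono fun z => ?_
        by_cases hz : z ∈ Metric.ball (0 : Plane) R
        · rw [Set.indicator_of_mem hz, Set.indicator_of_mem]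
          rw [mem_ball_zero_iff] at *
          have := norm_sub_le z x
          linarith
        · rw [Set.indicator_of_notMem hz]
          exact zero_le
    _ = _ := lintegral_sub_right_eq_self (μ := volume) _ x

/-- The Riesz potential of order one maps `L²` of a disk into `L^r` for every finite `r`. -/
theorem lintegral_riesz_rpow_le {r : ℝ} (hr : 2 ≤ r) (R : ℝ) {g : Plane → ℝ≥0∞}
    (hg : AEMeasurable g (volume.restrict (Metric.ball (0 : Plane) R))) :
    ∫⁻ x in Metric.ball (0 : Plane) R,
        (∫⁻ z in Metric.ball (0 : Plane) R, g z * ‖z - x‖ₑ⁻¹) ^ r ≤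
      (∫⁻ y in Metric.ball (0 : Plane) (2 * R), ‖y‖ₑ ^ (-(2 - 2 / r))) ^ (r / 2) *
        (∫⁻ y in Metric.ball (0 : Plane) (2 * R), ‖y‖ₑ ^ (-1 : ℝ)) *
        (∫⁻ z in Metric.ball (0 : Plane) R, g z ^ (2 : ℝ)) ^ (r / 2) := by
  set B := Metric.ball (0 : Plane) R
  set K₁ := ∫⁻ y in Metric.ball (0 : Plane) (2 * R), ‖y‖ₑ ^ (-(2 - 2 / r))
  set K₂ := ∫⁻ y in Metric.ball (0 : Plane) (2 * R), ‖y‖ₑ ^ (-1 : ℝ)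
  set A := ∫⁻ z in B, g z ^ (2 : ℝ)
  have hr0 : 0 < r := by linarith
  have h2r : 2 / r ≤ 1 := (div_le_one hr0).2 hr
  have hk : ∀ x : Plane, Measurable fun z : Plane => ‖z - x‖ₑ⁻¹ := fun x => by fun_prop
  -- Write `k` for the kernel. Cauchy-Schwarz for `g k = (g k^{1/r}) k^{1-1/r}` leaves `∫ g² k^{2/r}`,
  -- and Hölder's inequality with respect to the measure `g² dz` raises the power of `k` to one.
  have hpt : ∀ x ∈ B, (∫⁻ z in B, g z * ‖z - x‖ₑ⁻¹) ^ r ≤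
      K₁ ^ (r / 2) * (A ^ (r / 2 - 1) * ∫⁻ z in B, g z ^ (2 : ℝ) * ‖z - x‖ₑ⁻¹) := by
    intro x hx
    have hsplit : ∫⁻ z in B, g z * ‖z - x‖ₑ⁻¹ =
        ∫⁻ z in B, (g z * ‖z - x‖ₑ⁻¹ ^ (1 / r)) * ‖z - x‖ₑ⁻¹ ^ (1 - 1 / r) := by
      refine lintegral_congr fun z => ?_
      have h1r : 1 / r ≤ 1 := (div_le_one hr0).2 (by linarith)
      rw [mul_assoc, ← ENNReal.rpow_add_of_nonneg _ _ (by positivity) (by linarith)]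
      simp
    have hCS : ∫⁻ z in B, g z * ‖z - x‖ₑ⁻¹ ≤
        (∫⁻ z in B, g z ^ (2 : ℝ) * ‖z - x‖ₑ⁻¹ ^ (2 / r)) ^ (1 / 2 : ℝ) * K₁ ^ (1 / 2 : ℝ) := by
      rw [hsplit]
      refine (ENNReal.lintegral_mul_le_Lp_mul_Lq _ Real.HolderConjugate.two_two
        (hg.mul ((hk x).pow_const _).aemeasurable) ((hk x).pow_const _).aemeasurable).trans ?_
      gcongr ?_ ^ _ * ?_ ^ _
      · refine lintegral_mono fun z => le_of_eq ?_
        simp only [Pi.mul_apply]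
        rw [ENNReal.mul_rpow_of_nonneg _ _ (by norm_num), ← ENNReal.rpow_mul]
        ring_nf
      · refine le_trans (le_of_eq ?_) (setLIntegral_enorm_sub_rpow_neg_le (b := 2 - 2 / r) hx)
        refine lintegral_congr fun z => ?_
        rw [← ENNReal.rpow_mul, ENNReal.inv_rpow, ← ENNReal.rpow_neg]
        ring_nf
    have hJ : ∫⁻ z in B, g z ^ (2 : ℝ) * ‖z - x‖ₑ⁻¹ ^ (2 / r) ≤
        A ^ (1 - 2 / r) * (∫⁻ z in B, g z ^ (2 : ℝ) * ‖z - x‖ₑ⁻¹) ^ (2 / r) := by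
      refine le_trans (le_of_eq ?_) (ENNReal.lintegral_mul_norm_pow_le (hg.pow_const 2)
        ((hg.pow_const 2).mul (hk x).aemeasurable) (sub_nonneg.2 h2r) (by positivity) (by ring))
      refine lintegral_congr fun z => ?_
      simp only [Pi.mul_apply]
      rw [ENNReal.mul_rpow_of_nonneg _ _ (by positivity), ← mul_assoc,
        ← ENNReal.rpow_add_of_nonneg _ _ (sub_nonneg.2 h2r) (by positivity)]
      simp
    calc (∫⁻ z in B, g z * ‖z - x‖ₑ⁻¹) ^ r
        ≤ ((A ^ (1 - 2 / r) * (∫⁻ z in B, g z ^ (2 : ℝ) * ‖z - x‖ₑ⁻¹) ^ (2 / r)) ^ (1 / 2 : ℝ)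
            * K₁ ^ (1 / 2 : ℝ)) ^ r := by
          gcongr
          exact hCS.trans (by gcongr)
      _ = _ := by
          rw [ENNReal.mul_rpow_of_nonneg _ _ hr0.le, ← ENNReal.rpow_mul, ← ENNReal.rpow_mul,
            ENNReal.mul_rpow_of_nonneg _ _ (by positivity), ← ENNReal.rpow_mul, ← ENNReal.rpow_mul,
            mul_comm]
          have e1 : (1 - 2 / r) * (1 / 2 * r) = r / 2 - 1 := by field_simp
          have e2 : 2 / r * (1 / 2 * r) = 1 := by field_simp
          rw [e1, e2, ENNReal.rpow_one]
          ring_nf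
  have hT : ∫⁻ x in B, ∫⁻ z in B, g z ^ (2 : ℝ) * ‖z - x‖ₑ⁻¹ ≤ K₂ * A := by
    rw [lintegral_lintegral_swap]
    · calc _ = ∫⁻ z in B, g z ^ (2 : ℝ) * ∫⁻ x in B, ‖z - x‖ₑ⁻¹ := by
            refine lintegral_congr fun z => ?_
            rw [lintegral_const_mul]
            fun_prop
        _ ≤ ∫⁻ z in B, g z ^ (2 : ℝ) * K₂ := by
            refine setLIntegral_mono' measurableSet_ball fun z hz => ?_
            gcongr
            refine le_trans (le_of_eq ?_) (setLIntegral_enorm_sub_rpow_neg_le (b := 1) hz)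
            refine lintegral_congr fun x => ?_
            rw [ENNReal.rpow_neg_one, enorm_sub_rev]
        _ = K₂ * A := by rw [lintegral_mul_const'' _ (hg.pow_const 2), mul_comm]
    · refine AEMeasurable.mul ?_ (by fun_prop)
      exact (hg.pow_const 2).comp_snd
  calc _ ≤ ∫⁻ x in B, K₁ ^ (r / 2) * (A ^ (r / 2 - 1) * ∫⁻ z in B, g z ^ (2 : ℝ) * ‖z - x‖ₑ⁻¹) :=
        setLIntegral_mono' measurableSet_ball hpt
    _ = K₁ ^ (r / 2) * (A ^ (r / 2 - 1) * ∫⁻ x in B, ∫⁻ z in B, g z ^ (2 : ℝ) * ‖z - x‖ₑ⁻¹) := by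
        have hm : AEMeasurable (fun x => ∫⁻ z in B, g z ^ (2 : ℝ) * ‖z - x‖ₑ⁻¹)
            (volume.restrict B) := by
          refine AEMeasurable.lintegral_prod_right' (f := fun p : Plane × Plane =>
            g p.2 ^ (2 : ℝ) * ‖p.2 - p.1‖ₑ⁻¹) ?_
          exact (hg.pow_const 2).comp_snd.mul (by fun_prop)
        rw [lintegral_const_mul'' _ (hm.const_mul _), lintegral_const_mul'' _ hm]
    _ ≤ K₁ ^ (r / 2) * (A ^ (r / 2 - 1) * (K₂ * A)) := by gcongr
    _ = _ := by
        rw [show r / 2 = (r / 2 - 1) + 1 by ring,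
          ENNReal.rpow_add_of_nonneg (x := A) _ _ (by linarith) zero_le_one, ENNReal.rpow_one]
        ring_nf

/-! ### A pointwise Poincaré inequality on disks -/

theorem lintegral_comp_add_smul_plane {h : Plane → ℝ≥0∞} (hh : Measurable h) (x : Plane) {t : ℝ}
    (ht : 0 < t) :
    ∫⁻ y, h (x + t • (y - x)) = ENNReal.ofReal (t ^ (-2 : ℝ)) * ∫⁻ z, h z := by
  rw [lintegral_sub_right_eq_self (μ := volume) (fun y => h (x + t • y)) x]
  have hm := Measure.map_addHaar_smul (volume : Measure Plane) ht.ne'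
  have h1 : ∫⁻ y : Plane, h (x + t • y) = ∫⁻ z, h (x + z) ∂(volume.map (t • · : Plane → Plane)) :=
    (lintegral_map (f := fun z => h (x + z)) (by fun_prop) (by fun_prop)).symm
  rw [h1, hm, lintegral_smul_measure, lintegral_add_left_eq_self (μ := volume) h x, smul_eq_mul]
  congr 2
  rw [finrank_euclideanSpace, Fintype.card_fin, abs_of_pos (by positivity), Real.rpow_neg ht.le]
  norm_num

theorem lintegral_Ioi_rpow_neg_three {c : ℝ} (hc : 0 < c) :
    ∫⁻ t in Set.Ioi c, ENNReal.ofReal (t ^ (-3 : ℝ)) = ENNReal.ofReal (c ^ (-2 : ℝ) / 2) := by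
  rw [← ofReal_integral_eq_lintegral_ofReal (integrableOn_Ioi_rpow_of_lt (by norm_num) hc)]
  · rw [integral_Ioi_rpow_of_lt (by norm_num) hc]
    norm_num
  · filter_upwards [ae_restrict_mem measurableSet_Ioi] with t ht
    exact Real.rpow_nonneg (hc.trans ht).le _

/-- Among the segments of length less than `2 R` that issue from a point, those that reach distance
`d` at time `t` have `t > d / (2 R)`; this bounds the total weight that the segments give to a point
at distance `d`. -/
theorem lintegral_segment_weight_le (H : ℝ≥0∞) {d R : ℝ} (hd : 0 < d) (hR : 0 < R) :
    ∫⁻ t in Set.Ioc (0 : ℝ) 1, ENNReal.ofReal (t ^ (-2 : ℝ)) *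
        (H * (ENNReal.ofReal (t⁻¹) * ENNReal.ofReal d) *
          (Set.Ioi (d / (2 * R))).indicator 1 t) ≤
      ENNReal.ofReal (2 * R ^ 2) * (H * (ENNReal.ofReal d)⁻¹) := by
  have e1 : ∀ t ∈ Set.Ioc (0 : ℝ) 1, ENNReal.ofReal (t ^ (-2 : ℝ)) *
        (H * (ENNReal.ofReal (t⁻¹) * ENNReal.ofReal d) *
          (Set.Ioi (d / (2 * R))).indicator 1 t) =
      H * ENNReal.ofReal d * (Set.Ioi (d / (2 * R))).indicator
        (fun t => ENNReal.ofReal (t ^ (-3 : ℝ))) t := by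
    intro t ht
    by_cases hti : t ∈ Set.Ioi (d / (2 * R))
    · rw [Set.indicator_of_mem hti, Set.indicator_of_mem hti, Pi.one_apply, mul_one]
      have e2 : t ^ (-3 : ℝ) = t ^ (-2 : ℝ) * t⁻¹ := by
        rw [← Real.rpow_neg_one t, ← Real.rpow_add ht.1]; norm_num
      rw [e2, ENNReal.ofReal_mul (by have := ht.1; positivity)]
      ring
    · rw [Set.indicator_of_notMem hti, Set.indicator_of_notMem hti]
      simp
  have hm : Measurable ((Set.Ioi (d / (2 * R))).indicator
      (fun t : ℝ => ENNReal.ofReal (t ^ (-3 : ℝ)))) :=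
    Measurable.indicator (by fun_prop) measurableSet_Ioi
  rw [setLIntegral_congr_fun measurableSet_Ioc e1, lintegral_const_mul _ hm]
  refine (mul_le_mul_right (setLIntegral_le_lintegral _ _) _).trans (le_of_eq ?_)
  rw [lintegral_indicator measurableSet_Ioi, lintegral_Ioi_rpow_neg_three (by positivity),
    mul_assoc, mul_left_comm (ENNReal.ofReal (2 * R ^ 2))]
  congr 1
  rw [← ENNReal.ofReal_inv_of_pos hd, ← ENNReal.ofReal_mul hd.le,
    ← ENNReal.ofReal_mul (by positivity)]
  congr 1
  rw [Real.rpow_neg (by positivity), Real.rpow_two]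
  field_simp

/-- Integrating a nonnegative function over all segments from `x` to the points of a disk that
contains `x` gives at most a multiple of its Riesz potential at `x`. -/
theorem lintegral_segment_le_riesz {h : Plane → ℝ≥0∞} (hh : Measurable h) {R : ℝ} (hR : 0 < R)
    {x : Plane} (hx : x ∈ Metric.ball (0 : Plane) R) :
    ∫⁻ y in Metric.ball (0 : Plane) R, ∫⁻ t in Set.Ioc (0 : ℝ) 1,
        h (x + t • (y - x)) * ‖y - x‖ₑ ≤
      ENNReal.ofReal (2 * R ^ 2) * ∫⁻ z in Metric.ball (0 : Plane) R, h z * ‖z - x‖ₑ⁻¹ := by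
  set B := Metric.ball (0 : Plane) R
  -- The point `z = x + t (y - x)` lies in the disk, and `|z - x| = t |y - x| < 2 R t`.
  -- `ψ t z` bounds the integrand at time `t` in terms of `z`, where `|y - x| = |z - x| / t`.
  obtain ⟨ψ, hψ⟩ : ∃ ψ : ℝ → Plane → ℝ≥0∞, ∀ t z, ψ t z = B.indicator
      (fun z => h z * (ENNReal.ofReal (t⁻¹) * ‖z - x‖ₑ)) z *
        (Set.Ioi (‖z - x‖ / (2 * R))).indicator 1 t := ⟨_, fun _ _ => rfl⟩
  have hset : MeasurableSet {p : ℝ × Plane | ‖p.2 - x‖ / (2 * R) < p.1} :=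
    measurableSet_lt (by fun_prop) (by fun_prop)
  have hψm : Measurable fun p : ℝ × Plane => ψ p.1 p.2 := by
    have h1 : Measurable ((Prod.snd ⁻¹' B : Set (ℝ × Plane)).indicator
        fun p : ℝ × Plane => h p.2 * (ENNReal.ofReal (p.1⁻¹) * ‖p.2 - x‖ₑ)) :=
      Measurable.indicator (by fun_prop) (measurable_snd measurableSet_ball)
    have h2 : Measurable ({p : ℝ × Plane | ‖p.2 - x‖ / (2 * R) < p.1}.indicator
        (1 : ℝ × Plane → ℝ≥0∞)) := measurable_one.indicator hset
    simp only [hψ]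
    exact h1.mul h2
  have hle : ∀ y ∈ B, ∀ t ∈ Set.Ioc (0 : ℝ) 1,
      h (x + t • (y - x)) * ‖y - x‖ₑ ≤ ψ t (x + t • (y - x)) := by
    intro y hy t ht
    by_cases hyx : y = x
    · simp [hyx]
    have hmem : x + t • (y - x) ∈ B := by
      have := (convex_ball (0 : Plane) R).add_smul_sub_mem hx hy ⟨ht.1.le, ht.2⟩
      exact this
    have hnorm : ‖x + t • (y - x) - x‖ = t * ‖y - x‖ := by
      rw [add_sub_cancel_left, norm_smul, Real.norm_of_nonneg ht.1.le]
    have hlt : ‖x + t • (y - x) - x‖ / (2 * R) < t := by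
      rw [hnorm, div_lt_iff₀ (by positivity)]
      have h1 := norm_sub_le y x
      have h2 := mem_ball_zero_iff.1 hx
      have h3 := mem_ball_zero_iff.1 hy
      have := ht.1
      nlinarith
    simp only [hψ]
    rw [Set.indicator_of_mem hmem, Set.indicator_of_mem (Set.mem_Ioi.2 hlt), Pi.one_apply, mul_one]
    refine le_of_eq ?_
    congr 1
    rw [← ofReal_norm (x + t • (y - x) - x), hnorm, ← ENNReal.ofReal_mul (inv_nonneg.2 ht.1.le),
      inv_mul_cancel_left₀ ht.1.ne', ofReal_norm]
  have hψ₁ : Measurable (Function.uncurry fun (y : Plane) (t : ℝ) => ψ t (x + t • (y - x))) :=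
    hψm.comp (by fun_prop : Measurable fun p : Plane × ℝ => (p.2, x + p.2 • (p.1 - x)))
  have hψ₂ : Measurable (Function.uncurry fun (t : ℝ) (z : Plane) =>
      ENNReal.ofReal (t ^ (-2 : ℝ)) * ψ t z) :=
    Measurable.mul (f := fun p : ℝ × Plane => ENNReal.ofReal (p.1 ^ (-2 : ℝ))) (by fun_prop) hψm
  have hψt : ∀ t : ℝ, Measurable (ψ t) := fun t => hψm.comp (by fun_prop : Measurable fun z => (t, z))
  calc _ ≤ ∫⁻ y in B, ∫⁻ t in Set.Ioc (0 : ℝ) 1, ψ t (x + t • (y - x)) := by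
        refine setLIntegral_mono' measurableSet_ball fun y hy => ?_
        exact setLIntegral_mono' measurableSet_Ioc fun t ht => hle y hy t ht
    _ ≤ ∫⁻ y, ∫⁻ t in Set.Ioc (0 : ℝ) 1, ψ t (x + t • (y - x)) := setLIntegral_le_lintegral _ _
    _ = ∫⁻ t in Set.Ioc (0 : ℝ) 1, ∫⁻ y, ψ t (x + t • (y - x)) := by
        exact lintegral_lintegral_swap hψ₁.aemeasurable
    _ = ∫⁻ t in Set.Ioc (0 : ℝ) 1, ∫⁻ z, ENNReal.ofReal (t ^ (-2 : ℝ)) * ψ t z := by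
        refine setLIntegral_congr_fun measurableSet_Ioc fun t ht => ?_
        rw [lintegral_comp_add_smul_plane (hψt t) x ht.1, lintegral_const_mul _ (hψt t)]
    _ = ∫⁻ z, ∫⁻ t in Set.Ioc (0 : ℝ) 1, ENNReal.ofReal (t ^ (-2 : ℝ)) * ψ t z := by
        exact lintegral_lintegral_swap hψ₂.aemeasurable
    _ ≤ ∫⁻ z, B.indicator (fun z => ENNReal.ofReal (2 * R ^ 2) * (h z * ‖z - x‖ₑ⁻¹)) z := by
        refine lintegral_mono_ae ?_
        filter_upwards [Measure.ae_ne volume x] with z hzx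
        by_cases hz : z ∈ B
        · rw [Set.indicator_of_mem hz]
          have hd : 0 < ‖z - x‖ := norm_pos_iff.2 (sub_ne_zero.2 hzx)
          simp only [hψ, Set.indicator_of_mem hz]
          rw [← ofReal_norm (z - x)]
          exact lintegral_segment_weight_le (h z) hd hR
        · simp [hψ, hz]
    _ = _ := by
        rw [lintegral_indicator measurableSet_ball, lintegral_const_mul _ (by fun_prop)]

/-- On a disk the mean deviation of a `C¹` function from its value at `x` is controlled by the
Riesz potential of its gradient at `x`. -/
theorem ContDiff.lintegral_enorm_sub_le_riesz {u : Plane → ℝ} (hu : ContDiff ℝ 1 u) {R : ℝ}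
    (hR : 0 < R) {x : Plane} (hx : x ∈ Metric.ball (0 : Plane) R) :
    ∫⁻ y in Metric.ball (0 : Plane) R, ‖u y - u x‖ₑ ≤
      ENNReal.ofReal (2 * R ^ 2) *
        ∫⁻ z in Metric.ball (0 : Plane) R, ‖fderiv ℝ u z‖ₑ * ‖z - x‖ₑ⁻¹ := by
  have hc : Continuous (fderiv ℝ u) := hu.continuous_fderiv one_ne_zero
  refine le_trans ?_ (lintegral_segment_le_riesz (h := fun z => ‖fderiv ℝ u z‖ₑ)
    hc.enorm.measurable hR hx)
  refine lintegral_mono fun y => ?_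
  have hderiv : ∀ t ∈ Set.uIcc (0 : ℝ) 1, HasDerivAt (fun t : ℝ => u (x + t • (y - x)))
      (fderiv ℝ u (x + t • (y - x)) (y - x)) t := by
    intro t _
    have h1 : HasDerivAt (fun t : ℝ => x + t • (y - x)) (y - x) t := by
      simpa using ((hasDerivAt_id t).smul_const (y - x)).const_add x
    exact ((hu.differentiable one_ne_zero _).hasFDerivAt).comp_hasDerivAt t h1
  have hcont : Continuous fun t : ℝ => fderiv ℝ u (x + t • (y - x)) (y - x) := by fun_prop
  have hftc := intervalIntegral.integral_eq_sub_of_hasDerivAt hderiv (hcont.intervalIntegrable 0 1)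
  simp only [one_smul, add_sub_cancel, zero_smul, add_zero] at hftc
  rw [← hftc, intervalIntegral.integral_of_le zero_le_one]
  refine (enorm_integral_le_lintegral_enorm _).trans ?_
  refine lintegral_mono fun t => ?_
  exact ContinuousLinearMap.le_opENorm _ _

/-! ### Mollification -/

section Mollification

open scoped Convolution

variable {E' : Type*} [NormedAddCommGroup E'] [NormedSpace ℝ E']

/-- The convolution of `f` with a normalised bump function. -/
noncomputable def mollify (φ : ContDiffBump (0 : Plane)) (f : Plane → E') : Plane → E' :=
  φ.normed volume ⋆[ContinuousLinearMap.lsmul ℝ ℝ, volume] f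

theorem lintegral_enorm_mollify_le (φ : ContDiffBump (0 : Plane)) {f : Plane → E'}
    (hf : AEStronglyMeasurable f volume) :
    ∫⁻ x, ‖mollify φ f x‖ₑ ≤ ∫⁻ x, ‖f x‖ₑ := by
  have hm : AEMeasurable (Function.uncurry fun (x t : Plane) =>
      ‖φ.normed volume t • f (x - t)‖ₑ) (volume.prod volume) :=
    (AEStronglyMeasurable.convolution_integrand (ContinuousLinearMap.lsmul ℝ ℝ)
      φ.continuous_normed.aestronglyMeasurable hf).enorm
  calc ∫⁻ x, ‖mollify φ f x‖ₑ ≤ ∫⁻ x, ∫⁻ t, ‖φ.normed volume t • f (x - t)‖ₑ :=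
        lintegral_mono fun x => enorm_integral_le_lintegral_enorm _
    _ = ∫⁻ t, ∫⁻ x, ‖φ.normed volume t • f (x - t)‖ₑ := lintegral_lintegral_swap hm
    _ = ∫⁻ t, ‖φ.normed volume t‖ₑ * ∫⁻ x, ‖f x‖ₑ := by
        refine lintegral_congr fun t => ?_
        simp only [enorm_smul]
        rw [lintegral_const_mul' _ _ enorm_ne_top,
          lintegral_sub_right_eq_self (μ := volume) (fun x => ‖f x‖ₑ) t]
    _ = (∫⁻ t, ‖φ.normed volume t‖ₑ) * ∫⁻ x, ‖f x‖ₑ :=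
        lintegral_mul_const _ φ.continuous_normed.enorm.measurable
    _ = ∫⁻ x, ‖f x‖ₑ := by
        have : ∫⁻ t, ‖φ.normed (volume : Measure Plane) t‖ₑ = 1 := by
          rw [← ofReal_integral_norm_eq_lintegral_enorm φ.integrable_normed]
          simp only [Real.norm_of_nonneg (φ.nonneg_normed _), φ.integral_normed,
            ENNReal.ofReal_one]
        rw [this, one_mul]

theorem mollify_sub (φ : ContDiffBump (0 : Plane)) {f g : Plane → E'}
    (hf : LocallyIntegrable f volume) (hg : LocallyIntegrable g volume) :
    mollify φ (f - g) = mollify φ f - mollify φ g := by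
  have h : ∀ {k : Plane → E'}, LocallyIntegrable k volume →
      ConvolutionExists (φ.normed volume) k (ContinuousLinearMap.lsmul ℝ ℝ) volume :=
    fun hk => φ.hasCompactSupport_normed.convolutionExists_left _ φ.continuous_normed hk
  funext x
  simp only [mollify, convolution_def, Pi.sub_apply, map_sub]
  exact integral_sub (h hf x) (h hg x)

/-- Mollifications of an integrable function converge to it in `L¹`. -/
theorem tendsto_lintegral_enorm_mollify_sub [CompleteSpace E'] {φ : ℕ → ContDiffBump (0 : Plane)}
    (hφ : Tendsto (fun n => (φ n).rOut) atTop (𝓝 0)) {f : Plane → E'}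
    (hf : Integrable f volume) :
    Tendsto (fun n => ∫⁻ x, ‖mollify (φ n) f x - f x‖ₑ) atTop (𝓝 0) := by
  rw [ENNReal.tendsto_nhds_zero]
  intro ε hε
  have hε3 : ε / 3 ≠ 0 := by simpa using hε.ne'
  obtain ⟨g, hgc, hfg, hg, hgi⟩ := hf.exists_hasCompactSupport_lintegral_sub_le hε3
  -- For compactly supported continuous `g` the convergence is uniform, on a fixed compact set.
  have hgn : ∀ᶠ n in atTop, ∫⁻ x, ‖mollify (φ n) g x - g x‖ₑ ≤ ε / 3 := by
    set K := Metric.cthickening 1 (tsupport g)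
    have hK : IsCompact K := hgc.isCompact.cthickening
    obtain ⟨δ, hδ, hδK⟩ : ∃ δ : ℝ, 0 < δ ∧ ENNReal.ofReal δ * volume K ≤ ε / 3 := by
      have h1 : Tendsto (fun δ : ℝ => ENNReal.ofReal δ * volume K) (𝓝[>] 0) (𝓝 0) := by
        have h2 : Tendsto (fun δ : ℝ => ENNReal.ofReal δ) (𝓝[>] 0) (𝓝 0) := by
          simpa using (ENNReal.continuous_ofReal.tendsto 0).mono_left nhdsWithin_le_nhds
        simpa using ENNReal.Tendsto.mul_const h2 (Or.inr hK.measure_lt_top.ne)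
      obtain ⟨δ, hδ1, hδ2⟩ := ((ENNReal.tendsto_nhds_zero.1 h1 _ (pos_iff_ne_zero.2 hε3)).and
        self_mem_nhdsWithin).exists
      exact ⟨δ, hδ2, hδ1⟩
    obtain ⟨η, hη, hgη⟩ := Metric.uniformContinuous_iff.1
      (hgc.uniformContinuous_of_continuous hg) δ hδ
    filter_upwards [hφ.eventually (gt_mem_nhds hη), hφ.eventually (gt_mem_nhds one_pos)]
      with n hn hn1
    refine le_trans ?_ hδK
    rw [← setLIntegral_const, ← lintegral_indicator hK.isClosed.measurableSet]
    refine lintegral_mono fun x => ?_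
    by_cases hx : x ∈ K
    · rw [Set.indicator_of_mem hx, ← ofReal_norm, ← dist_eq_norm]
      refine ENNReal.ofReal_le_ofReal ((φ n).dist_normed_convolution_le hg.aestronglyMeasurable ?_)
      intro y hy
      exact (hgη ((Metric.mem_ball.1 hy).trans hn)).le
    · rw [Set.indicator_of_notMem hx, ← ofReal_norm, ← dist_eq_norm]
      refine le_trans (ENNReal.ofReal_le_ofReal ((φ n).dist_normed_convolution_le (ε := 0)
        hg.aestronglyMeasurable ?_)) (by simp)
      have hz : ∀ y ∈ Metric.ball x (φ n).rOut, g y = 0 := by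
        intro y hy
        refine image_eq_zero_of_notMem_tsupport fun hy' => hx ?_
        refine Metric.mem_cthickening_of_dist_le x y 1 _ hy' ?_
        rw [dist_comm]
        exact (Metric.mem_ball.1 hy).le.trans hn1.le
      intro y hy
      rw [hz y hy, hz x (Metric.mem_ball_self (φ n).rOut_pos), dist_self]
  filter_upwards [hgn] with n hn
  have hsub := mollify_sub (φ n) hf.locallyIntegrable hgi.locallyIntegrable
  have hm1 : AEStronglyMeasurable (mollify (φ n) (f - g)) volume :=
    ((φ n).integrable_normed.integrable_convolution _ (hf.sub hgi)).aestronglyMeasurable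
  have hm2 : AEStronglyMeasurable (mollify (φ n) g) volume :=
    ((φ n).integrable_normed.integrable_convolution _ hgi).aestronglyMeasurable
  calc ∫⁻ x, ‖mollify (φ n) f x - f x‖ₑ
      ≤ ∫⁻ x, (‖mollify (φ n) (f - g) x‖ₑ + ‖mollify (φ n) g x - g x‖ₑ) + ‖f x - g x‖ₑ := by
        refine lintegral_mono fun x => ?_
        have : mollify (φ n) f x - f x = mollify (φ n) (f - g) x + (mollify (φ n) g x - g x)
            - (f x - g x) := by
          rw [hsub, Pi.sub_apply]; abel
        rw [this]
        exact enorm_sub_le.trans (add_le_add_left (enorm_add_le _ _) _)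
    _ = (∫⁻ x, ‖mollify (φ n) (f - g) x‖ₑ) + (∫⁻ x, ‖mollify (φ n) g x - g x‖ₑ)
          + ∫⁻ x, ‖f x - g x‖ₑ := by
        have hm3 : AEMeasurable (fun x => ‖mollify (φ n) (f - g) x‖ₑ + ‖mollify (φ n) g x - g x‖ₑ) :=
          hm1.enorm.add (hm2.sub hgi.aestronglyMeasurable).enorm
        rw [lintegral_add_left' hm3, lintegral_add_left' hm1.enorm]
    _ ≤ ε / 3 + ε / 3 + ε / 3 := by
        gcongr
        exact (lintegral_enorm_mollify_le _ (hf.sub hgi).aestronglyMeasurable).trans hfg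
    _ = ε := ENNReal.add_thirds ε

theorem contDiff_mollify [CompleteSpace E'] (φ : ContDiffBump (0 : Plane)) {f : Plane → E'}
    (hf : LocallyIntegrable f volume) : ContDiff ℝ ∞ (mollify φ f) :=
  φ.hasCompactSupport_normed.contDiff_convolution_left _ φ.contDiff_normed hf

/-- At points whose distance to the complement of `Ω` exceeds the mollification radius, the
derivative of the mollification is the mollification of the weak gradient. -/
theorem IsWeakGradient.fderiv_mollify {Ω : Set Plane} (hΩ : IsOpen Ω) {v : Plane → ℝ}
    {G : Plane → Plane} (h : IsWeakGradient Ω v G) (hv : IntegrableOn v Ω) (hG : IntegrableOn G Ω)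
    (φ : ContDiffBump (0 : Plane)) {x : Plane} (hx : Metric.closedBall x φ.rOut ⊆ Ω) :
    fderiv ℝ (mollify φ (Ω.indicator v)) x = innerSL ℝ (mollify φ (Ω.indicator G) x) := by
  have hvi : Integrable (Ω.indicator v) := hv.integrable_indicator hΩ.measurableSet
  have hGi : Integrable (Ω.indicator G) := hG.integrable_indicator hΩ.measurableSet
  set ρ := φ.normed (volume : Measure Plane)
  have hρ : ContDiff ℝ ∞ ρ := φ.contDiff_normed
  have hρc : HasCompactSupport ρ := φ.hasCompactSupport_normed
  ext w
  have hderiv : fderiv ℝ (mollify φ (Ω.indicator v)) x =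
      (fderiv ℝ ρ ⋆[(ContinuousLinearMap.lsmul ℝ ℝ).precompL Plane, volume] (Ω.indicator v)) x :=
    (hρc.hasFDerivAt_convolution_left (ContinuousLinearMap.lsmul ℝ ℝ)
      (hρ.of_le (by simp)) hvi.locallyIntegrable x).fderiv
  rw [innerSL_apply_apply, hderiv]
  have hL : ((fderiv ℝ ρ ⋆[(ContinuousLinearMap.lsmul ℝ ℝ).precompL Plane, volume]
      (Ω.indicator v)) x) w = ∫ t in Ω, v t * fderiv ℝ ρ (x - t) w := by
    rw [convolution_eq_swap, ContinuousLinearMap.integral_apply]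
    · rw [← integral_indicator hΩ.measurableSet]
      refine integral_congr_ae (Eventually.of_forall fun t => ?_)
      by_cases ht : t ∈ Ω
      · simp [ht, ContinuousLinearMap.precompL_apply, mul_comm]
      · simp [ht]
    · exact convolutionExistsAt_iff_integrable_swap.1 ((hρc.fderiv ℝ).convolutionExists_left _
        (hρ.continuous_fderiv (by simp)) hvi.locallyIntegrable x)
  have hR : inner ℝ (mollify φ (Ω.indicator G) x) w = ∫ t in Ω, inner ℝ (G t) w * ρ (x - t) := by
    rw [mollify, convolution_eq_swap, real_inner_comm, ← integral_inner]
    · rw [← integral_indicator hΩ.measurableSet]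
      refine integral_congr_ae (Eventually.of_forall fun t => ?_)
      by_cases ht : t ∈ Ω
      · simp [ht, inner_smul_right, real_inner_comm, mul_comm, ρ]
      · simp [ht]
    · exact convolutionExistsAt_iff_integrable_swap.1 (hρc.convolutionExists_left _
        hρ.continuous hGi.locallyIntegrable x)
  have htest := h.integral_eq (fun t => ρ (x - t)) (hρ.comp (contDiff_const.sub contDiff_id))
    (hρc.comp_homeomorph (Homeomorph.subLeft x)) ?_ w
  · have hd : ∀ t, fderiv ℝ (fun t => ρ (x - t)) t w = - fderiv ℝ ρ (x - t) w := by
      intro t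
      have h1 : HasFDerivAt (fun t => ρ (x - t))
          ((fderiv ℝ ρ (x - t)).comp (-ContinuousLinearMap.id ℝ Plane)) t :=
        ((hρ.differentiable (by simp) _).hasFDerivAt).comp t ((hasFDerivAt_id t).const_sub x)
      rw [h1.fderiv]
      simp
    simp only [hd, mul_neg, integral_neg, neg_inj] at htest
    rw [hL, hR, htest]
  · intro t ht
    refine hx ?_
    have h2 : t ∈ (Homeomorph.subLeft x) ⁻¹' tsupport ρ := by
      rw [← tsupport_comp_eq_preimage]
      exact ht
    rw [φ.tsupport_normed_eq] at h2
    simpa [dist_eq_norm, norm_sub_rev] using h2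

/-- A weakly differentiable function is approximated in `L¹`, together with its gradient, by smooth
functions on sets that stay away from the boundary. -/
theorem IsWeakGradient.exists_contDiff_tendsto {Ω : Set Plane} (hΩ : IsOpen Ω) {v : Plane → ℝ}
    {G : Plane → Plane} (h : IsWeakGradient Ω v G) (hv : IntegrableOn v Ω) (hG : IntegrableOn G Ω)
    {K : Set Plane} {δ : ℝ} (hδ : 0 < δ) (hK : MeasurableSet K) (hKδ : Metric.thickening δ K ⊆ Ω) :
    ∃ u : ℕ → Plane → ℝ, (∀ n, ContDiff ℝ ∞ (u n)) ∧
      Tendsto (fun n => ∫⁻ x in K, ‖u n x - v x‖ₑ) atTop (𝓝 0) ∧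
      Tendsto (fun n => ∫⁻ x in K, ‖fderiv ℝ (u n) x - innerSL ℝ (G x)‖ₑ) atTop (𝓝 0) ∧
      ∀ᵐ x ∂volume.restrict K, Tendsto (fun n => u n x) atTop (𝓝 (v x)) := by
  have hvi : Integrable (Ω.indicator v) := hv.integrable_indicator hΩ.measurableSet
  have hGi : Integrable (Ω.indicator G) := hG.integrable_indicator hΩ.measurableSet
  have hKΩ : K ⊆ Ω := (Metric.self_subset_thickening hδ K).trans hKδ
  let φ : ℕ → ContDiffBump (0 : Plane) := fun n =>
    ⟨1 / (2 * ((n : ℝ) + 1)), 1 / ((n : ℝ) + 1), by positivity, by gcongr; linarith⟩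
  have hφ : Tendsto (fun n => (φ n).rOut) atTop (𝓝 0) := tendsto_one_div_add_atTop_nhds_zero_nat
  refine ⟨fun n => mollify (φ n) (Ω.indicator v), fun n => contDiff_mollify _ hvi.locallyIntegrable,
    ?_, ?_, ?_⟩
  · refine tendsto_of_tendsto_of_tendsto_of_le_of_le tendsto_const_nhds
      (tendsto_lintegral_enorm_mollify_sub hφ hvi) (fun n => zero_le) (fun n => ?_)
    refine le_trans (le_of_eq ?_) (setLIntegral_le_lintegral K _)
    refine setLIntegral_congr_fun hK fun x hx => ?_
    simp only [Set.indicator_of_mem (hKΩ hx)]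
  · refine tendsto_of_tendsto_of_tendsto_of_le_of_le' tendsto_const_nhds
      (tendsto_lintegral_enorm_mollify_sub hφ hGi) (Eventually.of_forall fun n => zero_le) ?_
    filter_upwards [hφ.eventually (gt_mem_nhds hδ)] with n hn
    refine le_trans (le_of_eq ?_) (setLIntegral_le_lintegral K _)
    refine setLIntegral_congr_fun hK fun x hx => ?_
    have hx' : Metric.closedBall x (φ n).rOut ⊆ Ω := by
      intro y hy
      exact hKδ (Metric.mem_thickening_iff.2 ⟨x, hx, (Metric.mem_closedBall.1 hy).trans_lt hn⟩)
    simp only [h.fderiv_mollify hΩ hv hG (φ n) hx']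
    rw [Set.indicator_of_mem (hKΩ hx), ← map_sub, ← ofReal_norm, ← ofReal_norm, innerSL_apply_norm]
  · rw [ae_restrict_iff' hK]
    filter_upwards [ContDiffBump.ae_convolution_tendsto_right_of_locallyIntegrable
      (K := 2) hφ (Eventually.of_forall fun n => (by simp only [φ]; field_simp; norm_num))
      hvi.locallyIntegrable] with x hx hxK
    rwa [Set.indicator_of_mem (hKΩ hxK)] at hx

end Mollification

/-! ### Calculus of weak gradients -/

theorem setIntegral_eq_setIntegral_of_forall_notMem_eq_zero {K Ω : Set Plane} (hK : K ⊆ Ω)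
    {f : Plane → ℝ} (hf : ∀ x, x ∉ K → f x = 0) : ∫ x in Ω, f x = ∫ x in K, f x := by
  rw [setIntegral_eq_integral_of_forall_compl_eq_zero fun x hx => hf x fun h => hx (hK h),
    setIntegral_eq_integral_of_forall_compl_eq_zero hf]

theorem isWeakGradient_gradient {Ω : Set Plane} {u : Plane → ℝ} (hu : ContDiff ℝ 1 u) :
    IsWeakGradient Ω u (gradient u) := by
  have hG : Continuous (gradient u) :=
    (InnerProductSpace.toDual ℝ Plane).symm.continuous.comp (hu.continuous_fderiv one_ne_zero)
  refine ⟨hu.continuous.locallyIntegrable.locallyIntegrableOn _,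
    hG.locallyIntegrable.locallyIntegrableOn _, fun φ hφ hc hs w => ?_⟩
  have hφ1 : Continuous fun x => fderiv ℝ φ x w :=
    (hφ.continuous_fderiv (by simp)).clm_apply continuous_const
  have hu1 : Continuous fun x => fderiv ℝ u x w :=
    (hu.continuous_fderiv one_ne_zero).clm_apply continuous_const
  have hc1 : HasCompactSupport fun x => fderiv ℝ φ x w := hc.fderiv_apply ℝ w
  rw [setIntegral_eq_integral_of_forall_compl_eq_zero, setIntegral_eq_integral_of_forall_compl_eq_zero]
  · simp only [inner_gradient_left]
    refine integral_mul_fderiv_eq_neg_fderiv_mul_of_integrable ?_ ?_ ?_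
      (fun x _ => hu.differentiable one_ne_zero x) (fun x _ => hφ.differentiable (by simp) x)
    · exact (hu1.mul hφ.continuous).integrable_of_hasCompactSupport hc.mul_left
    · exact (hu.continuous.mul hφ1).integrable_of_hasCompactSupport hc1.mul_left
    · exact (hu.continuous.mul hφ.continuous).integrable_of_hasCompactSupport hc.mul_left
  · intro x hx
    rw [image_eq_zero_of_notMem_tsupport fun h => hx (hs h), mul_zero]
  · intro x hx
    rw [fderiv_of_notMem_tsupport ℝ fun h => hx (hs h)]
    simp

theorem IsWeakGradient.congr {Ω : Set Plane} {v v' : Plane → ℝ}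
    {G G' : Plane → Plane} (h : IsWeakGradient Ω v G) (hv : v =ᵐ[volume.restrict Ω] v')
    (hG : G =ᵐ[volume.restrict Ω] G') : IsWeakGradient Ω v' G' := by
  refine ⟨?_, ?_, fun φ hφ hc hs w => ?_⟩
  · intro x hx
    obtain ⟨s, hs, hi⟩ := h.locallyIntegrableOn_fun x hx
    refine ⟨s ∩ Ω, inter_mem hs self_mem_nhdsWithin, ?_⟩
    exact (hi.mono_set Set.inter_subset_left).congr
      (ae_mono (Measure.restrict_mono Set.inter_subset_right le_rfl) hv)
  · intro x hx
    obtain ⟨s, hs, hi⟩ := h.locallyIntegrableOn_grad x hx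
    refine ⟨s ∩ Ω, inter_mem hs self_mem_nhdsWithin, ?_⟩
    exact (hi.mono_set Set.inter_subset_left).congr
      (ae_mono (Measure.restrict_mono Set.inter_subset_right le_rfl) hG)
  · have h1 := h.integral_eq φ hφ hc hs w
    have e1 : ∫ x in Ω, v x * fderiv ℝ φ x w = ∫ x in Ω, v' x * fderiv ℝ φ x w :=
      integral_congr_ae (hv.mono fun x hx => by simp only [hx])
    have e2 : ∫ x in Ω, inner ℝ (G x) w * φ x = ∫ x in Ω, inner ℝ (G' x) w * φ x :=
      integral_congr_ae (hG.mono fun x hx => by simp only [hx])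
    rw [← e1, ← e2, h1]

/-- Chain rule for `C¹` functions with bounded derivative. -/
theorem IsWeakGradient.comp {Ω : Set Plane} (hΩ : IsOpen Ω) {v : Plane → ℝ}
    {G : Plane → Plane} (h : IsWeakGradient Ω v G) (hv : IntegrableOn v Ω) (hG : IntegrableOn G Ω)
    {F F' : ℝ → ℝ} (hF : ∀ s, HasDerivAt F (F' s) s) (hF' : Continuous F') {L : ℝ}
    (hL : ∀ s, |F' s| ≤ L) :
    IsWeakGradient Ω (fun x => F (v x)) (fun x => F' (v x) • G x) := by
  have hFc : Continuous F := continuous_iff_continuousAt.2 fun s => (hF s).continuousAt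
  have hL0 : 0 ≤ L := (abs_nonneg _).trans (hL 0)
  have hFL : ∀ s t, |F s - F t| ≤ L * |s - t| := by
    intro s t
    exact Convex.norm_image_sub_le_of_norm_hasDerivWithin_le
      (fun x _ => (hF x).hasDerivWithinAt) (fun x _ => hL x) convex_univ (Set.mem_univ t)
      (Set.mem_univ s)
  have hFd : ContDiff ℝ 1 F := by
    rw [contDiff_one_iff_deriv]
    refine ⟨fun s => (hF s).differentiableAt, ?_⟩
    rwa [show deriv F = F' from funext fun s => (hF s).deriv]
  have hG' : IntegrableOn (fun x => F' (v x) • G x) Ω :=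
    Integrable.bdd_smul hG L (hF'.comp_aestronglyMeasurable hv.aestronglyMeasurable)
      (Eventually.of_forall fun x => hL _)
  refine ⟨?_, hG'.locallyIntegrableOn, fun φ hφ hc hs w => ?_⟩
  · have h1 : IntegrableOn (fun x => F (v x) - F 0) Ω := by
      refine Integrable.mono' (hv.norm.const_mul L)
        ((hFc.comp_aestronglyMeasurable hv.aestronglyMeasurable).sub aestronglyMeasurable_const)
        (Eventually.of_forall fun x => ?_)
      simpa using hFL (v x) 0
    have h2 := h1.locallyIntegrableOn.add
      ((continuous_const (y := F 0)).locallyIntegrable.locallyIntegrableOn Ω (μ := volume))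
    refine h2.congr (Eventually.of_forall fun x => ?_)
    simp
  set K := tsupport φ
  have hK : IsCompact K := hc.isCompact
  have hKm : MeasurableSet K := hK.isClosed.measurableSet
  obtain ⟨δ, hδ, hKδ⟩ := hK.exists_thickening_subset_open hΩ hs
  obtain ⟨u, hu, huv, hug, hua⟩ := h.exists_contDiff_tendsto hΩ hv hG hδ hKm hKδ
  have hvK : IntegrableOn v K := hv.mono_set hs
  have hGK : IntegrableOn G K := hG.mono_set hs
  have hφw : Continuous fun x => fderiv ℝ φ x w :=
    (hφ.continuous_fderiv (by simp)).clm_apply continuous_const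
  obtain ⟨C₁, hC₁⟩ : ∃ C : ℝ, ∀ x, ‖fderiv ℝ φ x w‖ ≤ C :=
    hφw.bounded_above_of_compact_support (hc.fderiv_apply ℝ w)
  obtain ⟨C₂, hC₂⟩ : ∃ C : ℝ, ∀ x, ‖φ x‖ ≤ C := hφ.continuous.bounded_above_of_compact_support hc
  have hC₁0 : 0 ≤ C₁ := (norm_nonneg _).trans (hC₁ 0)
  have hC₂0 : 0 ≤ C₂ := (norm_nonneg _).trans (hC₂ 0)
  have z1 : ∀ f : Plane → ℝ, ∫ x in Ω, f x * fderiv ℝ φ x w = ∫ x in K, f x * fderiv ℝ φ x w := by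
    intro f
    refine setIntegral_eq_setIntegral_of_forall_notMem_eq_zero hs fun x hx => ?_
    rw [fderiv_of_notMem_tsupport ℝ hx]
    simp
  have z2 : ∀ f : Plane → ℝ, ∫ x in Ω, f x * φ x = ∫ x in K, f x * φ x := by
    intro f
    refine setIntegral_eq_setIntegral_of_forall_notMem_eq_zero hs fun x hx => ?_
    rw [image_eq_zero_of_notMem_tsupport hx, mul_zero]
  have hn : ∀ n, ∫ x in K, F (u n x) * fderiv ℝ φ x w =
      - ∫ x in K, F' (u n x) * fderiv ℝ (u n) x w * φ x := by
    intro n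
    have h1 := (isWeakGradient_gradient (Ω := Ω)
      (hFd.comp ((hu n).of_le (by simp)))).integral_eq φ hφ hc hs w
    rw [z1, z2] at h1
    simp only [inner_gradient_left] at h1
    have h2 : ∀ x, fderiv ℝ (F ∘ u n) x w = F' (u n x) * fderiv ℝ (u n) x w := by
      intro x
      rw [((hF (u n x)).comp_hasFDerivAt x
        ((hu n).differentiable (by simp) x).hasFDerivAt).fderiv]
      simp
    simp only [h2, Function.comp_apply] at h1
    exact h1
  have hum : ∀ n, Continuous (u n) := fun n => (hu n).continuous
  have hlim1 : Tendsto (fun n => ∫ x in K, F (u n x) * fderiv ℝ φ x w) atTop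
      (𝓝 (∫ x in K, F (v x) * fderiv ℝ φ x w)) := by
    refine tendsto_integral_of_L1 _ ((hFc.comp_aestronglyMeasurable hvK.aestronglyMeasurable).mul
      hφw.aestronglyMeasurable) (Eventually.of_forall fun n => ?_) ?_
    · exact ((hFc.comp (hum n)).mul hφw).continuousOn.integrableOn_compact hK
    · refine tendsto_of_tendsto_of_tendsto_of_le_of_le (g := fun _ => 0)
        (h := fun n => ENNReal.ofReal (L * C₁) * ∫⁻ x in K, ‖u n x - v x‖ₑ) tendsto_const_nhds ?_
        (fun n => zero_le) (fun n => ?_)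
      · simpa using ENNReal.Tendsto.const_mul huv (Or.inr ENNReal.ofReal_ne_top)
      · beta_reduce
        rw [← lintegral_const_mul' _ _ ENNReal.ofReal_ne_top]
        refine lintegral_mono fun x => ?_
        simp only [Pi.mul_apply]
        rw [← ofReal_norm, ← ofReal_norm, ← ENNReal.ofReal_mul (by positivity)]
        refine ENNReal.ofReal_le_ofReal ?_
        rw [← sub_mul, norm_mul]
        calc _ ≤ (L * ‖u n x - v x‖) * C₁ :=
              mul_le_mul (hFL _ _) (hC₁ x) (norm_nonneg _) (by positivity)
          _ = _ := by ring
  have hlim2 : Tendsto (fun n => ∫ x in K, F' (u n x) * fderiv ℝ (u n) x w * φ x) atTop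
      (𝓝 (∫ x in K, F' (v x) * inner ℝ (G x) w * φ x)) := by
    have hGw : IntegrableOn (fun x => inner ℝ (G x) w * φ x) K := by
      refine Integrable.mul_bdd (c := C₂) ?_ hφ.continuous.aestronglyMeasurable
        (Eventually.of_forall hC₂)
      exact hGK.inner_const w
    have hmv : AEStronglyMeasurable (fun x => F' (v x)) (volume.restrict K) :=
      hF'.comp_aestronglyMeasurable hvK.aestronglyMeasurable
    have hmu : ∀ n, Continuous fun x => F' (u n x) := fun n => hF'.comp (hum n)
    refine tendsto_integral_of_L1 _ ?_ (Eventually.of_forall fun n => ?_) ?_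
    · simp only [mul_assoc]
      exact hmv.mul hGw.aestronglyMeasurable
    · have : Continuous fun x => fderiv ℝ (u n) x w :=
        ((hu n).continuous_fderiv (by simp)).clm_apply continuous_const
      exact (((hmu n).mul this).mul hφ.continuous).continuousOn.integrableOn_compact hK
    · -- The difference splits as `F'(uₙ) (∇uₙ - G) φ + (F'(uₙ) - F'(v)) G φ`.
      have ha : Tendsto (fun n => ENNReal.ofReal (L * (‖w‖ * C₂)) *
          ∫⁻ x in K, ‖fderiv ℝ (u n) x - innerSL ℝ (G x)‖ₑ) atTop (𝓝 0) := by
        simpa using ENNReal.Tendsto.const_mul hug (Or.inr ENNReal.ofReal_ne_top)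
      have hb : Tendsto (fun n => ∫⁻ x in K, ‖(F' (u n x) - F' (v x)) * (inner ℝ (G x) w * φ x)‖ₑ)
          atTop (𝓝 0) := by
        have := tendsto_lintegral_of_dominated_convergence' (μ := volume.restrict K)
          (F := fun n x => ‖(F' (u n x) - F' (v x)) * (inner ℝ (G x) w * φ x)‖ₑ) (f := fun _ => 0)
          (fun x => ENNReal.ofReal (2 * L) * ‖inner ℝ (G x) w * φ x‖ₑ)
          (fun n => (((hmu n).aestronglyMeasurable.sub hmv).mul
            hGw.aestronglyMeasurable).enorm) ?_ ?_ ?_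
        · simpa using this
        · refine fun n => Eventually.of_forall fun x => ?_
          beta_reduce
          rw [enorm_mul]
          gcongr
          rw [← ofReal_norm]
          refine ENNReal.ofReal_le_ofReal ((norm_sub_le _ _).trans ?_)
          have h1 := hL (u n x)
          have h2 := hL (v x)
          simp only [Real.norm_eq_abs]
          linarith
        · rw [lintegral_const_mul' _ _ ENNReal.ofReal_ne_top]
          exact ENNReal.mul_ne_top ENNReal.ofReal_ne_top hGw.2.ne
        · filter_upwards [hua] with x hx
          have h1 : Tendsto (fun n => (F' (u n x) - F' (v x)) * (inner ℝ (G x) w * φ x)) atTop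
              (𝓝 ((F' (v x) - F' (v x)) * (inner ℝ (G x) w * φ x))) :=
            (((hF'.tendsto _).comp hx).sub_const _).mul_const _
          simpa using h1.enorm
      refine tendsto_of_tendsto_of_tendsto_of_le_of_le tendsto_const_nhds
        (by simpa only [add_zero] using ha.add hb) (fun n => zero_le) (fun n => ?_)
      rw [← lintegral_const_mul' _ _ ENNReal.ofReal_ne_top, ← lintegral_add_right']
      · refine lintegral_mono fun x => ?_
        have e : F' (u n x) * fderiv ℝ (u n) x w * φ x - F' (v x) * inner ℝ (G x) w * φ x =
            F' (u n x) * ((fderiv ℝ (u n) x - innerSL ℝ (G x)) w * φ x) +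
              (F' (u n x) - F' (v x)) * (inner ℝ (G x) w * φ x) := by
          simp only [sub_apply, innerSL_apply_apply]
          ring
        rw [e]
        refine (enorm_add_le _ _).trans (add_le_add_left ?_ _)
        rw [← ofReal_norm, ← ofReal_norm, ← ENNReal.ofReal_mul (by positivity)]
        refine ENNReal.ofReal_le_ofReal ?_
        rw [norm_mul, norm_mul]
        have h1 := ContinuousLinearMap.le_opNorm (fderiv ℝ (u n) x - innerSL ℝ (G x)) w
        calc _ ≤ L * ((‖fderiv ℝ (u n) x - innerSL ℝ (G x)‖ * ‖w‖) * C₂) := by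
              gcongr
              · exact hL _
              · exact hC₂ x
          _ = _ := by ring
      · exact (((hmu n).aestronglyMeasurable.sub hmv).mul hGw.aestronglyMeasurable).enorm
  have key := tendsto_nhds_unique (hlim1.congr hn) hlim2.neg
  rw [z1, z2, key]
  simp only [inner_smul_left, RCLike.conj_to_real]

/-- Weak gradients pass to dominated pointwise limits. -/
theorem IsWeakGradient.of_tendsto {Ω : Set Plane} {v : ℕ → Plane → ℝ}
    {G : ℕ → Plane → Plane} {v₀ : Plane → ℝ} {G₀ : Plane → Plane}
    (h : ∀ n, IsWeakGradient Ω (v n) (G n)) {a : Plane → ℝ} {b : Plane → ℝ}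
    (ha : IntegrableOn a Ω) (hb : IntegrableOn b Ω) (hva : ∀ n x, ‖v n x‖ ≤ a x)
    (hGb : ∀ n x, ‖G n x‖ ≤ b x)
    (hvm : ∀ n, AEStronglyMeasurable (v n) (volume.restrict Ω))
    (hGm : ∀ n, AEStronglyMeasurable (G n) (volume.restrict Ω))
    (hv : ∀ x, Tendsto (fun n => v n x) atTop (𝓝 (v₀ x)))
    (hG : ∀ x, Tendsto (fun n => G n x) atTop (𝓝 (G₀ x))) : IsWeakGradient Ω v₀ G₀ := by
  have hvi : IntegrableOn v₀ Ω := by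
    refine Integrable.mono' ha (aestronglyMeasurable_of_tendsto_ae atTop hvm
      (Eventually.of_forall hv)) (Eventually.of_forall fun x => ?_)
    exact le_of_tendsto (hv x).norm (Eventually.of_forall fun n => hva n x)
  have hGi : IntegrableOn G₀ Ω := by
    refine Integrable.mono' hb (aestronglyMeasurable_of_tendsto_ae atTop hGm
      (Eventually.of_forall hG)) (Eventually.of_forall fun x => ?_)
    exact le_of_tendsto (hG x).norm (Eventually.of_forall fun n => hGb n x)
  refine ⟨hvi.locallyIntegrableOn, hGi.locallyIntegrableOn, fun φ hφ hc hs w => ?_⟩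
  have hφw : Continuous fun x => fderiv ℝ φ x w :=
    (hφ.continuous_fderiv (by simp)).clm_apply continuous_const
  obtain ⟨C₁, hC₁⟩ : ∃ C : ℝ, ∀ x, ‖fderiv ℝ φ x w‖ ≤ C :=
    hφw.bounded_above_of_compact_support (hc.fderiv_apply ℝ w)
  obtain ⟨C₂, hC₂⟩ : ∃ C : ℝ, ∀ x, ‖φ x‖ ≤ C := hφ.continuous.bounded_above_of_compact_support hc
  have h1 : Tendsto (fun n => ∫ x in Ω, v n x * fderiv ℝ φ x w) atTop
      (𝓝 (∫ x in Ω, v₀ x * fderiv ℝ φ x w)) := by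
    refine tendsto_integral_of_dominated_convergence (fun x => a x * C₁)
      (fun n => (hvm n).mul hφw.aestronglyMeasurable) (ha.mul_const _)
      (fun n => Eventually.of_forall fun x => ?_)
      (Eventually.of_forall fun x => (hv x).mul_const _)
    rw [norm_mul]
    exact mul_le_mul (hva n x) (hC₁ x) (norm_nonneg _) ((norm_nonneg _).trans (hva n x))
  have h2 : Tendsto (fun n => ∫ x in Ω, inner ℝ (G n x) w * φ x) atTop
      (𝓝 (∫ x in Ω, inner ℝ (G₀ x) w * φ x)) := by
    refine tendsto_integral_of_dominated_convergence (fun x => (b x * ‖w‖) * C₂)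
      (fun n => ((hGm n).inner aestronglyMeasurable_const).mul hφ.continuous.aestronglyMeasurable)
      ((hb.mul_const _).mul_const _)
      (fun n => Eventually.of_forall fun x => ?_)
      (Eventually.of_forall fun x => ((hG x).inner tendsto_const_nhds).mul_const _)
    rw [norm_mul]
    have h3 : ‖inner ℝ (G n x) w‖ ≤ b x * ‖w‖ :=
      (norm_inner_le_norm _ _).trans (by gcongr; exact hGb n x)
    exact mul_le_mul h3 (hC₂ x) (norm_nonneg _) ((norm_nonneg _).trans h3)
  refine tendsto_nhds_unique (h1.congr fun n => (h n).integral_eq φ hφ hc hs w) h2.neg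

/-- The function `(s + √(s² + δ²) - δ) / 2` is a smooth regularisation of the positive part of `s`. -/
theorem hasDerivAt_smoothPosPart {δ : ℝ} (hδ : 0 < δ) (s : ℝ) :
    HasDerivAt (fun s : ℝ => (s + √(s ^ 2 + δ ^ 2) - δ) / 2)
      ((1 + s / √(s ^ 2 + δ ^ 2)) / 2) s := by
  have h1 : HasDerivAt (fun s : ℝ => s ^ 2 + δ ^ 2) (2 * s) s := by
    simpa using (hasDerivAt_pow 2 s).add_const (δ ^ 2)
  have h2 := h1.sqrt (by positivity)
  refine (((hasDerivAt_id s).add h2).sub_const δ).div_const 2 |>.congr_deriv ?_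
  field_simp

/-- The weak gradient of the positive part. On `{v = 0}` the regularisations give the factor `1/2`;
whether the gradient vanishes there is irrelevant for what follows. -/
theorem IsWeakGradient.posPart {Ω : Set Plane} (hΩ : IsOpen Ω) {v : Plane → ℝ}
    {G : Plane → Plane} (h : IsWeakGradient Ω v G) (hv : IntegrableOn v Ω)
    (hG : IntegrableOn G Ω) :
    IsWeakGradient Ω (fun x => max (v x) 0) (fun x => ((1 + Real.sign (v x)) / 2) • G x) := by
  let δ : ℕ → ℝ := fun n => 1 / ((n : ℝ) + 1)
  have hδ : ∀ n, 0 < δ n := fun n => by positivity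
  have hδ0 : Tendsto δ atTop (𝓝 0) := tendsto_one_div_add_atTop_nhds_zero_nat
  have hbd : ∀ n (s : ℝ), |(1 + s / √(s ^ 2 + δ n ^ 2)) / 2| ≤ 1 := by
    intro n s
    have h1 : |s / √(s ^ 2 + δ n ^ 2)| ≤ 1 := by
      rw [abs_div, abs_of_nonneg (Real.sqrt_nonneg _)]
      refine div_le_one_of_le₀ ?_ (Real.sqrt_nonneg _)
      exact Real.abs_le_sqrt (by nlinarith [sq_nonneg (δ n)])
    rw [abs_le] at h1 ⊢
    constructor <;> linarith [h1.1, h1.2]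
  have hcont : ∀ n, Continuous fun s : ℝ => (1 + s / √(s ^ 2 + δ n ^ 2)) / 2 := by
    intro n
    have : ∀ s : ℝ, √(s ^ 2 + δ n ^ 2) ≠ 0 := fun s => by have := hδ n; positivity
    fun_prop (disch := assumption)
  have hcomp := fun n => h.comp hΩ hv hG (fun s => hasDerivAt_smoothPosPart (hδ n) s)
    (hcont n) (hbd n)
  refine IsWeakGradient.of_tendsto hcomp hv.norm hG.norm ?_ ?_ ?_ ?_ ?_ ?_
  · intro n x
    have h1 : √(v x ^ 2 + δ n ^ 2) ≤ |v x| + δ n := by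
      refine Real.sqrt_le_iff.2 ⟨by have := hδ n; positivity, ?_⟩
      nlinarith [sq_abs (v x), abs_nonneg (v x), hδ n]
    have h2 : δ n ≤ √(v x ^ 2 + δ n ^ 2) := Real.le_sqrt_of_sq_le (by nlinarith [sq_nonneg (v x)])
    rw [Real.norm_eq_abs, Real.norm_eq_abs]
    rcases abs_cases (v x) with ⟨h3, h4⟩ | ⟨h3, h4⟩ <;> rw [abs_le] <;> constructor <;> linarith
  · intro n x
    rw [norm_smul, Real.norm_eq_abs]
    exact mul_le_of_le_one_left (norm_nonneg _) (hbd n _)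
  · intro n
    have : Continuous fun s : ℝ => (s + √(s ^ 2 + δ n ^ 2) - δ n) / 2 := by fun_prop
    exact this.comp_aestronglyMeasurable hv.aestronglyMeasurable
  · exact fun n => ((hcont n).comp_aestronglyMeasurable hv.aestronglyMeasurable).smul
      hG.aestronglyMeasurable
  · intro x
    have h1 : Continuous fun d : ℝ => (v x + √(v x ^ 2 + d ^ 2) - d) / 2 := by fun_prop
    have h2 := (h1.tendsto 0).comp hδ0
    have h3 : (v x + √(v x ^ 2 + 0 ^ 2) - 0) / 2 = max (v x) 0 := by
      rcases le_total 0 (v x) with h0 | h0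
      · simp [h0]
      · simp [Real.sqrt_sq_eq_abs, abs_of_nonpos h0, h0]
    rwa [h3] at h2
  · intro x
    refine Tendsto.smul_const ?_ (G x)
    rcases eq_or_ne (v x) 0 with h0 | h0
    · simp [h0]
    · have h1 : ContinuousAt (fun d : ℝ => (1 + v x / √(v x ^ 2 + d ^ 2)) / 2) 0 := by
        have : √(v x ^ 2 + 0 ^ 2) ≠ 0 := by positivity
        fun_prop (disch := assumption)
      have h2 := h1.tendsto.comp hδ0
      have h3 : (1 + v x / √(v x ^ 2 + 0 ^ 2)) / 2 = (1 + Real.sign (v x)) / 2 := by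
        congr 2
        rcases lt_or_gt_of_ne h0 with h4 | h4
        · rw [Real.sign_of_neg h4]
          simp [Real.sqrt_sq_eq_abs, abs_of_neg h4, h0]
        · rw [Real.sign_of_pos h4]
          simp [Real.sqrt_sq_eq_abs, abs_of_pos h4, h0]
      rwa [h3] at h2

/-- Composition with a linear isometry. -/
theorem IsWeakGradient.comp_linearIsometryEquiv {Ω : Set Plane} (hΩ : IsOpen Ω)
    {v : Plane → ℝ} {G : Plane → Plane} (h : IsWeakGradient Ω v G) (hv : IntegrableOn v Ω)
    (hG : IntegrableOn G Ω) (σ : Plane ≃ₗᵢ[ℝ] Plane) (hσ : σ ⁻¹' Ω = Ω) :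
    IsWeakGradient Ω (fun x => v (σ x)) (fun x => σ.symm (G (σ x))) := by
  have hmp : MeasurePreserving σ (volume.restrict Ω) (volume.restrict Ω) := by
    simpa only [hσ] using σ.measurePreserving.restrict_preimage hΩ.measurableSet
  have hemb : MeasurableEmbedding σ := σ.toHomeomorph.measurableEmbedding
  refine ⟨?_, ?_, fun φ hφ hc hs w => ?_⟩
  · exact IntegrableOn.locallyIntegrableOn ((hmp.integrable_comp_emb hemb).2 hv)
  · exact IntegrableOn.locallyIntegrableOn
      (σ.symm.integrable_comp_iff.2 ((hmp.integrable_comp_emb hemb).2 hG))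
  · have h1 := h.integral_eq (fun y => φ (σ.symm y)) (hφ.comp σ.symm.contDiff)
      (hc.comp_homeomorph σ.symm.toHomeomorph) ?_ (σ w)
    · rw [← hmp.integral_comp hemb fun y => v y * fderiv ℝ (fun y => φ (σ.symm y)) y (σ w),
        ← hmp.integral_comp hemb fun y => inner ℝ (G y) (σ w) * φ (σ.symm y)] at h1
      have e1 : ∀ x, fderiv ℝ (fun y => φ (σ.symm y)) (σ x) (σ w) = fderiv ℝ φ x w := by
        intro x
        have h2 : HasFDerivAt (fun y => φ (σ.symm y))
            ((fderiv ℝ φ (σ.symm (σ x))).comp (σ.symm : Plane →L[ℝ] Plane)) (σ x) :=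
          (hφ.differentiable (by simp) _).hasFDerivAt.comp (σ x)
            (σ.symm : Plane ≃L[ℝ] Plane).hasFDerivAt
        rw [h2.fderiv]
        simp
      have e2 : ∀ x, inner ℝ (G (σ x)) (σ w) = inner ℝ (σ.symm (G (σ x))) w := by
        intro x
        rw [← σ.inner_map_map (σ.symm (G (σ x))) w, σ.apply_symm_apply]
      simpa only [e1, e2, σ.symm_apply_apply] using h1
    · intro y hy
      have h2 : y ∈ σ.symm.toHomeomorph ⁻¹' tsupport φ := by
        rw [← tsupport_comp_eq_preimage]
        exact hy
      have h3 : σ.symm y ∈ Ω := hs h2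
      rw [← hσ] at h3
      simpa using h3

/-! ### Sobolev inequality on a disk -/

/-- The Poincaré inequality at almost every point of a strictly smaller disk, where smooth
approximations are available. -/
theorem IsWeakGradient.ae_lintegral_enorm_sub_le_riesz_of_lt {R R' : ℝ} (hR' : 0 < R')
    (hRR' : R' < R) {v : Plane → ℝ} {G : Plane → Plane}
    (h : IsWeakGradient (Metric.ball 0 R) v G) (hv : IntegrableOn v (Metric.ball 0 R))
    (hG : IntegrableOn G (Metric.ball 0 R)) :
    ∀ᵐ x ∂volume.restrict (Metric.ball (0 : Plane) R'),
      ∫⁻ y in Metric.ball (0 : Plane) R', ‖v y - v x‖ₑ ≤ ENNReal.ofReal (2 * R' ^ 2) *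
        ∫⁻ z in Metric.ball (0 : Plane) R', ‖G z‖ₑ * ‖z - x‖ₑ⁻¹ := by
  have hsub : Metric.thickening (R - R') (Metric.ball (0 : Plane) R') ⊆ Metric.ball 0 R := by
    intro x hx
    obtain ⟨y, hy, hxy⟩ := Metric.mem_thickening_iff.1 hx
    rw [Metric.mem_ball] at hy ⊢
    linarith [dist_triangle x y 0]
  have hKΩ : Metric.ball (0 : Plane) R' ⊆ Metric.ball 0 R := Metric.ball_subset_ball hRR'.le
  obtain ⟨u, hu, huv, hug, -⟩ := h.exists_contDiff_tendsto Metric.isOpen_ball hv hG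
    (sub_pos.2 hRR') measurableSet_ball hsub
  set B := Metric.ball (0 : Plane) R'
  set C := ENNReal.ofReal (2 * R' ^ 2)
  have hvm : AEStronglyMeasurable v (volume.restrict B) := (hv.mono_set hKΩ).aestronglyMeasurable
  have hGm : AEStronglyMeasurable G (volume.restrict B) := (hG.mono_set hKΩ).aestronglyMeasurable
  have hum : ∀ n, Continuous (u n) := fun n => (hu n).continuous
  have hum' : ∀ n, Continuous (fderiv ℝ (u n)) := fun n => (hu n).continuous_fderiv (by simp)
  have hgm : ∀ n, AEMeasurable (fun z => ‖fderiv ℝ (u n) z - innerSL ℝ (G z)‖ₑ)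
      (volume.restrict B) := fun n =>
    ((hum' n).aestronglyMeasurable.sub
      ((innerSL ℝ).continuous.comp_aestronglyMeasurable hGm)).enorm
  set D : Plane → ℝ≥0∞ := fun x => ∫⁻ y in B, ‖v y - v x‖ₑ with hD
  set I : Plane → ℝ≥0∞ := fun x => C * ∫⁻ z in B, ‖G z‖ₑ * ‖z - x‖ₑ⁻¹ with hI
  -- The error made by replacing `v` by its smooth approximation; it tends to zero in `L¹`.
  set err : ℕ → Plane → ℝ≥0∞ := fun n x => (∫⁻ y in B, ‖u n y - v y‖ₑ) +
    volume B * ‖u n x - v x‖ₑ +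
    C * ∫⁻ z in B, ‖fderiv ℝ (u n) z - innerSL ℝ (G z)‖ₑ * ‖z - x‖ₑ⁻¹ with herr
  have hDm : AEMeasurable D (volume.restrict B) := by
    have : AEMeasurable (fun p : Plane × Plane => ‖v p.2 - v p.1‖ₑ)
        ((volume.restrict B).prod (volume.restrict B)) :=
      (hvm.comp_snd.sub hvm.comp_fst).enorm
    exact this.lintegral_prod_right'
  have hker : ∀ {g : Plane → ℝ≥0∞}, AEMeasurable g (volume.restrict B) →
      AEMeasurable (fun p : Plane × Plane => g p.2 * ‖p.2 - p.1‖ₑ⁻¹)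
        ((volume.restrict B).prod (volume.restrict B)) := fun hg =>
    hg.comp_snd.mul (by fun_prop)
  have hIm : AEMeasurable I (volume.restrict B) :=
    ((hker hGm.enorm).lintegral_prod_right').const_mul C
  have hle : ∀ n, ∀ x ∈ B, D x ≤ I x + err n x := by
    intro n x hx
    have hs := ((hu n).of_le (by simp)).lintegral_enorm_sub_le_riesz hR' hx
    calc D x ≤ ∫⁻ y in B, ((‖u n y - v y‖ₑ + ‖u n y - u n x‖ₑ) + ‖u n x - v x‖ₑ) := by
          refine lintegral_mono fun y => ?_
          have : v y - v x = (u n y - u n x) - (u n y - v y) + (u n x - v x) := by ring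
          rw [this]
          refine (enorm_add_le _ _).trans (add_le_add_left ?_ _)
          rw [add_comm]
          exact enorm_sub_le
      _ = (∫⁻ y in B, ‖u n y - v y‖ₑ) + (∫⁻ y in B, ‖u n y - u n x‖ₑ) +
            volume B * ‖u n x - v x‖ₑ := by
          rw [lintegral_add_right _ measurable_const, lintegral_add_right, setLIntegral_const,
            mul_comm (volume B)]
          exact ((hum n).sub continuous_const).enorm.measurable
      _ ≤ (∫⁻ y in B, ‖u n y - v y‖ₑ) + (C * ∫⁻ z in B, ‖fderiv ℝ (u n) z‖ₑ * ‖z - x‖ₑ⁻¹) +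
            volume B * ‖u n x - v x‖ₑ := by gcongr
      _ ≤ (∫⁻ y in B, ‖u n y - v y‖ₑ) + (C * ((∫⁻ z in B, ‖G z‖ₑ * ‖z - x‖ₑ⁻¹) +
            ∫⁻ z in B, ‖fderiv ℝ (u n) z - innerSL ℝ (G z)‖ₑ * ‖z - x‖ₑ⁻¹)) +
            volume B * ‖u n x - v x‖ₑ := by
          gcongr
          have hgx : AEMeasurable (fun z => ‖fderiv ℝ (u n) z - innerSL ℝ (G z)‖ₑ * ‖z - x‖ₑ⁻¹)
              (volume.restrict B) := (hgm n).mul (by fun_prop)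
          rw [← lintegral_add_right' _ hgx]
          refine lintegral_mono fun z => ?_
          rw [← add_mul]
          gcongr
          rw [← ofReal_norm (G z), ← innerSL_apply_norm ℝ (G z), ← ofReal_norm, ← ofReal_norm,
            ← ENNReal.ofReal_add (norm_nonneg _) (norm_nonneg _)]
          exact ENNReal.ofReal_le_ofReal (norm_le_norm_add_norm_sub' _ _)
      _ = I x + err n x := by
          simp only [hI, herr]
          ring
  have herr0 : Tendsto (fun n => ∫⁻ x in B, err n x) atTop (𝓝 0) := by
    set K₂ := ∫⁻ y in Metric.ball (0 : Plane) (2 * R'), ‖y‖ₑ ^ (-1 : ℝ) with hK₂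
    have hK₂t : K₂ ≠ ⊤ := by
      rw [hK₂, lintegral_ball_enorm_rpow_neg (by norm_num) (by positivity)]
      exact ENNReal.ofReal_ne_top
    have hμ : volume B ≠ ⊤ := measure_ball_lt_top.ne
    have hb : ∀ n, ∫⁻ x in B, err n x ≤ 2 * volume B * (∫⁻ y in B, ‖u n y - v y‖ₑ) +
        C * K₂ * ∫⁻ z in B, ‖fderiv ℝ (u n) z - innerSL ℝ (G z)‖ₑ := by
      intro n
      have hm1 : AEMeasurable (fun x => ‖u n x - v x‖ₑ) (volume.restrict B) :=
        ((hum n).aestronglyMeasurable.sub hvm).enorm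
      have hm2 := (hker (hgm n)).lintegral_prod_right'
      have hT : ∫⁻ x in B, ∫⁻ z in B, ‖fderiv ℝ (u n) z - innerSL ℝ (G z)‖ₑ * ‖z - x‖ₑ⁻¹ ≤
          K₂ * ∫⁻ z in B, ‖fderiv ℝ (u n) z - innerSL ℝ (G z)‖ₑ := by
        rw [lintegral_lintegral_swap (hker (hgm n)), mul_comm, ← lintegral_mul_const'' _ (hgm n)]
        refine setLIntegral_mono' measurableSet_ball fun z hz => ?_
        rw [lintegral_const_mul _ (by fun_prop)]
        gcongr
        refine le_trans (le_of_eq ?_) (setLIntegral_enorm_sub_rpow_neg_le (b := 1) hz)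
        refine lintegral_congr fun x => ?_
        rw [ENNReal.rpow_neg_one, enorm_sub_rev]
      simp only [herr]
      rw [lintegral_add_right' _ (hm2.const_mul C), lintegral_add_right' _ (hm1.const_mul _),
        setLIntegral_const, lintegral_const_mul'' _ hm1, lintegral_const_mul'' _ hm2, two_mul,
        add_mul, mul_assoc C]
      rw [mul_comm (∫⁻ y in B, ‖u n y - v y‖ₑ)]
      gcongr
    refine tendsto_of_tendsto_of_tendsto_of_le_of_le tendsto_const_nhds ?_ (fun n => zero_le) hb
    have h1 := ENNReal.Tendsto.const_mul huv (a := 2 * volume B)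
      (Or.inr (ENNReal.mul_ne_top (by norm_num) hμ))
    have h2 := ENNReal.Tendsto.const_mul hug (a := C * K₂)
      (Or.inr (ENNReal.mul_ne_top ENNReal.ofReal_ne_top hK₂t))
    simpa using h1.add h2
  have hzero : ∫⁻ x in B, (D x - I x) = 0 := by
    refine le_antisymm (ge_of_tendsto' herr0 fun n => ?_) zero_le
    exact setLIntegral_mono' measurableSet_ball fun x hx => tsub_le_iff_left.2 (hle n x hx)
  filter_upwards [(lintegral_eq_zero_iff' (hDm.sub hIm)).1 hzero] with x hx
  exact tsub_eq_zero_iff_le.1 hx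

/-- On a disk the mean deviation of a weakly differentiable function from its value at `x` is
controlled by the Riesz potential of its gradient at `x`. -/
theorem IsWeakGradient.ae_lintegral_enorm_sub_le_riesz {R : ℝ} (hR : 0 < R) {v : Plane → ℝ}
    {G : Plane → Plane} (h : IsWeakGradient (Metric.ball 0 R) v G)
    (hv : IntegrableOn v (Metric.ball 0 R)) (hG : IntegrableOn G (Metric.ball 0 R)) :
    ∀ᵐ x ∂volume.restrict (Metric.ball (0 : Plane) R),
      ∫⁻ y in Metric.ball (0 : Plane) R, ‖v y - v x‖ₑ ≤ ENNReal.ofReal (2 * R ^ 2) *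
        ∫⁻ z in Metric.ball (0 : Plane) R, ‖G z‖ₑ * ‖z - x‖ₑ⁻¹ := by
  let ρ : ℕ → ℝ := fun k => R - R / ((k : ℝ) + 2)
  have hρ0 : ∀ k, 0 < ρ k := fun k => by
    have : R / ((k : ℝ) + 2) < R := div_lt_self hR (by have := k.cast_nonneg (α := ℝ); linarith)
    simp only [ρ]; linarith
  have hρR : ∀ k, ρ k < R := fun k => by
    have : 0 < R / ((k : ℝ) + 2) := by positivity
    simp only [ρ]; linarith
  have hρm : Monotone ρ := fun j k hjk => by
    have : R / ((k : ℝ) + 2) ≤ R / ((j : ℝ) + 2) := by gcongr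
    simp only [ρ]; linarith
  have hρt : Tendsto ρ atTop (𝓝 R) := by
    have h1 : Tendsto (fun k : ℕ => R / ((k : ℝ) + 2)) atTop (𝓝 0) :=
      tendsto_const_nhds.div_atTop (tendsto_atTop_add_const_right _ _ tendsto_natCast_atTop_atTop)
    simpa [ρ] using h1.const_sub R
  have hmono : Monotone fun k => Metric.ball (0 : Plane) (ρ k) := fun j k hjk =>
    Metric.ball_subset_ball (hρm hjk)
  have hU : ⋃ k, Metric.ball (0 : Plane) (ρ k) = Metric.ball 0 R := by
    ext x
    simp only [Set.mem_iUnion, mem_ball_zero_iff]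
    refine ⟨fun ⟨k, hk⟩ => hk.trans (hρR k), fun hx => ?_⟩
    exact (hρt.eventually (lt_mem_nhds hx)).exists
  have hall : ∀ᵐ x : Plane, ∀ k, x ∈ Metric.ball (0 : Plane) (ρ k) →
      ∫⁻ y in Metric.ball (0 : Plane) (ρ k), ‖v y - v x‖ₑ ≤ ENNReal.ofReal (2 * ρ k ^ 2) *
        ∫⁻ z in Metric.ball (0 : Plane) (ρ k), ‖G z‖ₑ * ‖z - x‖ₑ⁻¹ := by
    rw [ae_all_iff]
    intro k
    exact (ae_restrict_iff' measurableSet_ball).1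
      (h.ae_lintegral_enorm_sub_le_riesz_of_lt (hρ0 k) (hρR k) hv hG)
  rw [ae_restrict_iff' measurableSet_ball]
  filter_upwards [hall] with x hx hxR
  rw [← hU] at hxR
  obtain ⟨j, hj⟩ := Set.mem_iUnion.1 hxR
  nth_rewrite 1 [← hU]
  rw [setLIntegral_iUnion_of_directed _ hmono.directed_le]
  refine iSup_le fun k => ?_
  calc ∫⁻ y in Metric.ball (0 : Plane) (ρ k), ‖v y - v x‖ₑ
      ≤ ∫⁻ y in Metric.ball (0 : Plane) (ρ (max j k)), ‖v y - v x‖ₑ :=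
        lintegral_mono_set (hmono (le_max_right j k))
    _ ≤ _ := hx _ (hmono (le_max_left j k) hj)
    _ ≤ _ := by
        have := hρ0 (max j k)
        gcongr
        · exact (hρR _).le
        · exact (hρR _).le

/-- The Sobolev inequality, with any finite exponent, for functions of mean zero on a disk. -/
theorem IsWeakGradient.exists_sobolev {R : ℝ} (hR : 0 < R) {r : ℝ} (hr : 2 ≤ r) :
    ∃ C : ℝ≥0∞, C ≠ ⊤ ∧ ∀ (w : Plane → ℝ) (H : Plane → Plane),
      IsWeakGradient (Metric.ball 0 R) w H → IntegrableOn w (Metric.ball 0 R) →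
      IntegrableOn H (Metric.ball 0 R) → ∫ x in Metric.ball (0 : Plane) R, w x = 0 →
      eLpNorm w (ENNReal.ofReal r) (volume.restrict (Metric.ball 0 R)) ≤
        C * (∫⁻ x in Metric.ball (0 : Plane) R, ‖H x‖ₑ ^ (2 : ℝ)) ^ (1 / 2 : ℝ) := by
  have hr0 : 0 < r := by linarith
  set B := Metric.ball (0 : Plane) R
  set K₁ := ∫⁻ y in Metric.ball (0 : Plane) (2 * R), ‖y‖ₑ ^ (-(2 - 2 / r)) with hK₁
  set K₂ := ∫⁻ y in Metric.ball (0 : Plane) (2 * R), ‖y‖ₑ ^ (-1 : ℝ) with hK₂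
  have hK₁t : K₁ ≠ ⊤ := by
    have : 0 < 2 / r := by positivity
    rw [hK₁, lintegral_ball_enorm_rpow_neg (by linarith) (by positivity)]
    exact ENNReal.ofReal_ne_top
  have hK₂t : K₂ ≠ ⊤ := by
    rw [hK₂, lintegral_ball_enorm_rpow_neg (by norm_num) (by positivity)]
    exact ENNReal.ofReal_ne_top
  have hμ0 : volume B ≠ 0 := (Metric.measure_ball_pos volume 0 hR).ne'
  have hμt : volume B ≠ ⊤ := measure_ball_lt_top.ne
  have : IsFiniteMeasure (volume.restrict B) := isFiniteMeasure_restrict.2 hμt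
  set A := (volume B)⁻¹ * ENNReal.ofReal (2 * R ^ 2)
  have hAt : A ≠ ⊤ := ENNReal.mul_ne_top (ENNReal.inv_ne_top.2 hμ0) ENNReal.ofReal_ne_top
  refine ⟨A * (K₁ ^ (r / 2) * K₂) ^ (1 / r), ENNReal.mul_ne_top hAt
    (ENNReal.rpow_ne_top_of_nonneg (by positivity) (ENNReal.mul_ne_top
      (ENNReal.rpow_ne_top_of_nonneg (by positivity) hK₁t) hK₂t)), fun w H h hw hH h0 => ?_⟩
  have hpt : ∀ᵐ x ∂volume.restrict B, ‖w x‖ₑ ≤ A * ∫⁻ z in B, ‖H z‖ₑ * ‖z - x‖ₑ⁻¹ := by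
    filter_upwards [h.ae_lintegral_enorm_sub_le_riesz hR hw hH] with x hx
    have h1 : volume B * ‖w x‖ₑ ≤ ∫⁻ y in B, ‖w y - w x‖ₑ := by
      have h2 : ∫ y in B, (w y - w x) = - (volume.real B * w x) := by
        rw [integral_sub hw (integrable_const _), h0, setIntegral_const, zero_sub, smul_eq_mul]
      have h3 := enorm_integral_le_lintegral_enorm (μ := volume.restrict B) fun y => w y - w x
      rw [h2, enorm_neg, enorm_mul] at h3
      refine le_trans (le_of_eq ?_) h3
      rw [measureReal_def, Real.enorm_of_nonneg ENNReal.toReal_nonneg, ENNReal.ofReal_toReal hμt]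
    calc ‖w x‖ₑ = (volume B)⁻¹ * (volume B * ‖w x‖ₑ) := by
          rw [← mul_assoc, ENNReal.inv_mul_cancel hμ0 hμt, one_mul]
      _ ≤ (volume B)⁻¹ * (ENNReal.ofReal (2 * R ^ 2) * ∫⁻ z in B, ‖H z‖ₑ * ‖z - x‖ₑ⁻¹) := by
          exact mul_le_mul_right (h1.trans hx) _
      _ = _ := by rw [mul_assoc]
  have hm : AEMeasurable (fun x => ∫⁻ z in B, ‖H z‖ₑ * ‖z - x‖ₑ⁻¹) (volume.restrict B) := by
    have : AEMeasurable (fun p : Plane × Plane => ‖H p.2‖ₑ * ‖p.2 - p.1‖ₑ⁻¹)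
        ((volume.restrict B).prod (volume.restrict B)) :=
      hH.aestronglyMeasurable.enorm.comp_snd.mul (by fun_prop)
    exact this.lintegral_prod_right'
  have hS := lintegral_riesz_rpow_le hr R (g := fun z => ‖H z‖ₑ) hH.aestronglyMeasurable.enorm
  rw [eLpNorm_eq_lintegral_rpow_enorm_toReal (by simpa using hr0) ENNReal.ofReal_ne_top,
    ENNReal.toReal_ofReal hr0.le]
  calc (∫⁻ x in B, ‖w x‖ₑ ^ r) ^ (1 / r)
      ≤ (∫⁻ x in B, A ^ r * (∫⁻ z in B, ‖H z‖ₑ * ‖z - x‖ₑ⁻¹) ^ r) ^ (1 / r) := by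
        gcongr ?_ ^ _
        refine lintegral_mono_ae ?_
        filter_upwards [hpt] with x hx
        rw [← ENNReal.mul_rpow_of_nonneg _ _ hr0.le]
        gcongr
    _ = (A ^ r * ∫⁻ x in B, (∫⁻ z in B, ‖H z‖ₑ * ‖z - x‖ₑ⁻¹) ^ r) ^ (1 / r) := by
        rw [lintegral_const_mul'' _ (hm.pow_const r)]
    _ ≤ (A ^ r * (K₁ ^ (r / 2) * K₂ * (∫⁻ x in B, ‖H x‖ₑ ^ (2 : ℝ)) ^ (r / 2))) ^ (1 / r) := by
        gcongr
    _ = _ := by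
        have hi : 0 ≤ 1 / r := by positivity
        rw [ENNReal.mul_rpow_of_nonneg _ _ hi, ENNReal.mul_rpow_of_nonneg _ _ hi,
          ← ENNReal.rpow_mul, ← ENNReal.rpow_mul, mul_one_div_cancel hr0.ne', ENNReal.rpow_one,
          show r / 2 * (1 / r) = 1 / 2 by field_simp, mul_assoc A]

/-! ### The energy controls every `L^p` norm -/

theorem IsWeakGradient.weakGrad_ae_eq {Ω : Set Plane} (hΩ : IsOpen Ω) {v : Plane → ℝ}
    {G : Plane → Plane} (h : IsWeakGradient Ω v G) :
    weakGrad Ω v =ᵐ[volume.restrict Ω] G := by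
  have hex : ∃ G, IsWeakGradient Ω v G := ⟨G, h⟩
  rw [weakGrad, dif_pos hex]
  exact hex.choose_spec.ae_eq hΩ h

theorem IsWeakGradient.energy_eq {Ω : Set Plane} (hΩ : IsOpen Ω) {v : Plane → ℝ}
    {G : Plane → Plane} (h : IsWeakGradient Ω v G) (θ : ℝ) :
    energy Ω θ v = ∫⁻ x in Ω, ENNReal.ofReal (‖G x‖ ^ 2 / (1 + |v x|) ^ (2 * θ)) := by
  refine lintegral_congr_ae ?_
  filter_upwards [h.weakGrad_ae_eq hΩ] with x hx
  rw [hx]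

theorem IsWeakGradient.memW1 {Ω : Set Plane} (hΩ : IsOpen Ω) {v : Plane → ℝ}
    {G : Plane → Plane} (h : IsWeakGradient Ω v G) {q : ℝ}
    (hv : MemLp v (ENNReal.ofReal q) (volume.restrict Ω))
    (hG : MemLp G (ENNReal.ofReal q) (volume.restrict Ω)) : MemW1 Ω q v :=
  ⟨hv, ⟨G, h⟩, hG.ae_eq (h.weakGrad_ae_eq hΩ).symm⟩

/-- The function `s / (1 + s²)^{1/4}`. Its derivative is at most a multiple of `(1 + |s|)^{-θ}` when
`2 θ ≤ 1`, so that composing with it turns the energy into a Dirichlet integral. -/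
noncomputable def flatten (s : ℝ) : ℝ := s / √√(1 + s ^ 2)

/-- The derivative of `flatten`. -/
noncomputable def flattenDeriv (s : ℝ) : ℝ :=
  (1 - s ^ 2 / (2 * (1 + s ^ 2))) / √√(1 + s ^ 2)

theorem hasDerivAt_flatten (s : ℝ) : HasDerivAt flatten (flattenDeriv s) s := by
  have h0 : 0 < 1 + s ^ 2 := by positivity
  have h1 : HasDerivAt (fun s : ℝ => 1 + s ^ 2) (2 * s) s := by
    simpa using (hasDerivAt_pow 2 s).const_add 1
  have h2 := (h1.sqrt h0.ne').sqrt (by positivity)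
  refine ((hasDerivAt_id s).div h2 (by positivity)).congr_deriv ?_
  simp only [flattenDeriv, id]
  have e1 : √√(1 + s ^ 2) ^ 2 = √(1 + s ^ 2) := Real.sq_sqrt (by positivity)
  have e2 : √(1 + s ^ 2) ^ 2 = 1 + s ^ 2 := Real.sq_sqrt (by positivity)
  have hb : 0 < √√(1 + s ^ 2) := by positivity
  set b := √√(1 + s ^ 2)
  have e3 : 1 + s ^ 2 = b ^ 4 := by rw [← e2, ← e1]; ring
  rw [← e1, e3]
  field_simp

theorem continuous_flattenDeriv : Continuous flattenDeriv := by
  have h1 : ∀ s : ℝ, √√(1 + s ^ 2) ≠ 0 := fun s => by positivity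
  have h2 : ∀ s : ℝ, 2 * (1 + s ^ 2) ≠ 0 := fun s => by positivity
  unfold flattenDeriv
  fun_prop (disch := assumption)

theorem one_le_sqrt_sqrt (s : ℝ) : 1 ≤ √√(1 + s ^ 2) := by
  rw [Real.one_le_sqrt, Real.one_le_sqrt]
  nlinarith [sq_nonneg s]

theorem flattenDeriv_nonneg (s : ℝ) : 0 ≤ flattenDeriv s := by
  have : s ^ 2 / (2 * (1 + s ^ 2)) ≤ 1 := div_le_one_of_le₀ (by nlinarith [sq_nonneg s]) (by positivity)
  exact div_nonneg (by linarith) (by positivity)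

theorem flattenDeriv_le_inv (s : ℝ) : flattenDeriv s ≤ (√√(1 + s ^ 2))⁻¹ := by
  have : 0 ≤ s ^ 2 / (2 * (1 + s ^ 2)) := by positivity
  rw [flattenDeriv, div_eq_mul_inv]
  exact mul_le_of_le_one_left (by positivity) (by linarith)

theorem abs_flattenDeriv_le_one (s : ℝ) : |flattenDeriv s| ≤ 1 := by
  rw [abs_of_nonneg (flattenDeriv_nonneg s)]
  exact (flattenDeriv_le_inv s).trans (inv_le_one_of_one_le₀ (one_le_sqrt_sqrt s))

theorem flatten_neg (s : ℝ) : flatten (-s) = - flatten s := by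
  simp [flatten, neg_div]

theorem flattenDeriv_sq_le {θ : ℝ} (hθ : 2 * θ ≤ 1) (s : ℝ) :
    flattenDeriv s ^ 2 ≤ 2 / (1 + |s|) ^ (2 * θ) := by
  have h1 : (1 + |s|) ^ (2 * θ) ≤ 1 + |s| := by
    calc (1 + |s|) ^ (2 * θ) ≤ (1 + |s|) ^ (1 : ℝ) :=
          Real.rpow_le_rpow_of_exponent_le (by linarith [abs_nonneg s]) hθ
      _ = _ := Real.rpow_one _
  have h2 : 1 + |s| ≤ 2 * √(1 + s ^ 2) := by
    have h3 : |s| ≤ √(1 + s ^ 2) := Real.abs_le_sqrt (by linarith)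
    have h4 : 1 ≤ √(1 + s ^ 2) := Real.one_le_sqrt.2 (by nlinarith [sq_nonneg s])
    linarith
  have h0 : 0 < (1 + |s|) ^ (2 * θ) := Real.rpow_pos_of_pos (by positivity) _
  calc flattenDeriv s ^ 2 ≤ ((√√(1 + s ^ 2))⁻¹) ^ 2 := by
        gcongr
        · exact flattenDeriv_nonneg s
        · exact flattenDeriv_le_inv s
    _ = 1 / √(1 + s ^ 2) := by
        rw [inv_pow, Real.sq_sqrt (by positivity), one_div]
    _ ≤ 2 / (1 + |s|) ^ (2 * θ) := by
        rw [div_le_div_iff₀ (by positivity) h0]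
        linarith

theorem abs_le_flatten (s : ℝ) : |s| ≤ 2 * |flatten s| + 2 * |flatten s| ^ 2 := by
  have hb : 1 ≤ √√(1 + s ^ 2) := one_le_sqrt_sqrt s
  have e1 : √√(1 + s ^ 2) ^ 2 = √(1 + s ^ 2) := Real.sq_sqrt (by positivity)
  have h2 : √(1 + s ^ 2) ≤ 1 + |s| := by
    refine Real.sqrt_le_iff.2 ⟨by positivity, ?_⟩
    nlinarith [sq_abs s, abs_nonneg s]
  rw [flatten, abs_div, abs_of_nonneg (Real.sqrt_nonneg _)]
  set b := √√(1 + s ^ 2)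
  have hb0 : 0 < b := by linarith
  have e2 : 2 * (|s| / b) + 2 * (|s| / b) ^ 2 = |s| * (2 * b + 2 * |s|) / b ^ 2 := by
    field_simp
  rw [e2, le_div_iff₀ (by positivity)]
  gcongr
  linarith [abs_nonneg s]

/-- The energy controls every `L^p` norm, `2 ≤ p < ∞`, on the functions `v` for which the flattened
function has mean zero. -/
theorem exists_eLpNorm_le_energy {R θ p : ℝ} (hR : 0 < R) (hθ : 2 * θ ≤ 1) (hp : 2 ≤ p) :
    ∃ C : ℝ≥0∞, C ≠ ⊤ ∧ ∀ (v : Plane → ℝ) (G : Plane → Plane),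
      IsWeakGradient (Metric.ball 0 R) v G → IntegrableOn v (Metric.ball 0 R) →
      IntegrableOn G (Metric.ball 0 R) → ∫ x in Metric.ball (0 : Plane) R, flatten (v x) = 0 →
      eLpNorm v (ENNReal.ofReal p) (volume.restrict (Metric.ball 0 R)) ≤
        C * (energy (Metric.ball 0 R) θ v ^ (1 / 2 : ℝ) + energy (Metric.ball 0 R) θ v) := by
  obtain ⟨C₁, hC₁, hS₁⟩ := IsWeakGradient.exists_sobolev hR hp
  obtain ⟨C₂, hC₂, hS₂⟩ := IsWeakGradient.exists_sobolev hR (r := p * 2) (by linarith)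
  have hp0 : 0 < p := by linarith
  refine ⟨2 * (C₁ * 2 ^ (1 / 2 : ℝ)) + 2 * (C₂ ^ 2 * 2), by finiteness, fun v G h hv hG h0 => ?_⟩
  set B := Metric.ball (0 : Plane) R
  have hcomp := h.comp Metric.isOpen_ball hv hG hasDerivAt_flatten continuous_flattenDeriv
    abs_flattenDeriv_le_one
  have hfc : Continuous flatten :=
    continuous_iff_continuousAt.2 fun s => (hasDerivAt_flatten s).continuousAt
  have hwm : AEStronglyMeasurable (fun x => flatten (v x)) (volume.restrict B) :=
    hfc.comp_aestronglyMeasurable hv.aestronglyMeasurable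
  have hw : IntegrableOn (fun x => flatten (v x)) B := by
    refine Integrable.mono hv hwm (Eventually.of_forall fun x => ?_)
    rw [flatten, norm_div, Real.norm_of_nonneg (Real.sqrt_nonneg _)]
    exact div_le_self (norm_nonneg _) (one_le_sqrt_sqrt _)
  have hH : IntegrableOn (fun x => flattenDeriv (v x) • G x) B :=
    Integrable.bdd_smul hG 1
      (continuous_flattenDeriv.comp_aestronglyMeasurable hv.aestronglyMeasurable)
      (Eventually.of_forall fun x => abs_flattenDeriv_le_one _)
  set E := energy B θ v with hE
  have hD : (∫⁻ x in B, ‖flattenDeriv (v x) • G x‖ₑ ^ (2 : ℝ)) ≤ 2 * E := by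
    rw [hE, h.energy_eq Metric.isOpen_ball, ← lintegral_const_mul' _ _ (by norm_num)]
    refine lintegral_mono fun x => ?_
    have h22 : ∀ a : ℝ, 2 * ENNReal.ofReal a = ENNReal.ofReal (2 * a) := fun a => by
      rw [ENNReal.ofReal_mul (by norm_num)]; simp
    rw [← ofReal_norm, ENNReal.ofReal_rpow_of_nonneg (norm_nonneg _) (by norm_num), h22]
    refine ENNReal.ofReal_le_ofReal ?_
    rw [Real.rpow_two, norm_smul, mul_pow, Real.norm_eq_abs, sq_abs]
    calc flattenDeriv (v x) ^ 2 * ‖G x‖ ^ 2 ≤ 2 / (1 + |v x|) ^ (2 * θ) * ‖G x‖ ^ 2 := by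
          gcongr
          exact flattenDeriv_sq_le hθ _
      _ = _ := by ring
  have hhalf : (2 * E) ^ (1 / 2 : ℝ) = 2 ^ (1 / 2 : ℝ) * E ^ (1 / 2 : ℝ) :=
    ENNReal.mul_rpow_of_nonneg _ _ (by norm_num)
  have h1 : eLpNorm (fun x => flatten (v x)) (ENNReal.ofReal p) (volume.restrict B) ≤
      C₁ * (2 ^ (1 / 2 : ℝ) * E ^ (1 / 2 : ℝ)) := by
    rw [← hhalf]
    exact (hS₁ _ _ hcomp hw hH h0).trans (by gcongr)
  have h2 : eLpNorm (fun x => flatten (v x)) (ENNReal.ofReal (p * 2)) (volume.restrict B) ^ 2 ≤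
      C₂ ^ 2 * (2 * E) := by
    calc _ ≤ (C₂ * (2 * E) ^ (1 / 2 : ℝ)) ^ 2 := by
          gcongr
          exact (hS₂ _ _ hcomp hw hH h0).trans (by gcongr)
      _ = _ := by
          rw [mul_pow, ← ENNReal.rpow_natCast ((2 * E) ^ (1 / 2 : ℝ)), ← ENNReal.rpow_mul]
          norm_num
  have hsq : eLpNorm (fun x => ‖flatten (v x)‖ ^ 2) (ENNReal.ofReal p) (volume.restrict B) =
      eLpNorm (fun x => flatten (v x)) (ENNReal.ofReal (p * 2)) (volume.restrict B) ^ 2 := by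
    have := eLpNorm_norm_rpow (μ := volume.restrict B) (p := ENNReal.ofReal p)
      (fun x => flatten (v x)) (q := 2) (by norm_num)
    rw [← ENNReal.ofReal_mul hp0.le] at this
    simpa using this
  have hp1 : 1 ≤ ENNReal.ofReal p := by
    rw [← ENNReal.ofReal_one]
    exact ENNReal.ofReal_le_ofReal (by linarith)
  calc eLpNorm v (ENNReal.ofReal p) (volume.restrict B)
      ≤ eLpNorm ((2 : ℝ) • (fun x => ‖flatten (v x)‖) + (2 : ℝ) • (fun x => ‖flatten (v x)‖ ^ 2))
          (ENNReal.ofReal p) (volume.restrict B) := by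
        refine eLpNorm_mono_real fun x => ?_
        exact abs_le_flatten (v x)
    _ ≤ eLpNorm ((2 : ℝ) • (fun x => ‖flatten (v x)‖)) (ENNReal.ofReal p) (volume.restrict B) +
          eLpNorm ((2 : ℝ) • (fun x => ‖flatten (v x)‖ ^ 2)) (ENNReal.ofReal p)
            (volume.restrict B) :=
        eLpNorm_add_le (hwm.norm.const_smul _) ((hwm.norm.pow 2).const_smul _) hp1
    _ ≤ 2 * (C₁ * (2 ^ (1 / 2 : ℝ) * E ^ (1 / 2 : ℝ))) + 2 * (C₂ ^ 2 * (2 * E)) := by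
        have h22 : ‖(2 : ℝ)‖ₑ = 2 := by
          rw [Real.enorm_of_nonneg (by norm_num)]; simp
        rw [eLpNorm_const_smul, eLpNorm_const_smul, eLpNorm_norm, hsq, h22]
        gcongr
    _ = 2 * (C₁ * 2 ^ (1 / 2 : ℝ)) * E ^ (1 / 2 : ℝ) + 2 * (C₂ ^ 2 * 2) * E := by ring
    _ ≤ _ := by
        rw [mul_add]
        gcongr
        · exact le_self_add
        · exact le_add_self

/-! ### Antisymmetric functions -/

section Antisymmetric

variable {R : ℝ} {e : Plane} {v : Plane → ℝ}

theorem reflection_preimage_ball (e : Plane) (R : ℝ) :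
    (Submodule.span ℝ {e})ᗮ.reflection ⁻¹' Metric.ball (0 : Plane) R = Metric.ball 0 R := by
  simp

theorem measurePreserving_reflection_ball (e : Plane) (R : ℝ) :
    MeasurePreserving (Submodule.span ℝ {e})ᗮ.reflection
      (volume.restrict (Metric.ball (0 : Plane) R)) (volume.restrict (Metric.ball 0 R)) := by
  have := (Submodule.span ℝ {e})ᗮ.reflection.measurePreserving.restrict_preimage
    (measurableSet_ball (x := (0 : Plane)) (ε := R))
  rwa [reflection_preimage_ball] at this

theorem measurableEmbedding_reflection (e : Plane) :
    MeasurableEmbedding (Submodule.span ℝ {e})ᗮ.reflection :=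
  (Submodule.span ℝ {e})ᗮ.reflection.toHomeomorph.measurableEmbedding

theorem IsAntisymmetric.integral_comp_eq_zero (h : IsAntisymmetric (Metric.ball 0 R) e v)
    {F : ℝ → ℝ} (hF : ∀ s, F (-s) = - F s) : ∫ x in Metric.ball (0 : Plane) R, F (v x) = 0 := by
  have h1 := (measurePreserving_reflection_ball e R).integral_comp
    (measurableEmbedding_reflection e) fun x => F (v x)
  have h2 : ∫ x in Metric.ball (0 : Plane) R, F (v ((Submodule.span ℝ {e})ᗮ.reflection x)) =
      - ∫ x in Metric.ball (0 : Plane) R, F (v x) := by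
    rw [← integral_neg]
    refine integral_congr_ae ?_
    filter_upwards [h] with x hx
    rw [hx, hF]
  linarith

/-- The length of the weak gradient of an antisymmetric function is symmetric. -/
theorem IsAntisymmetric.norm_grad_ae_eq (h : IsAntisymmetric (Metric.ball 0 R) e v)
    {G : Plane → Plane} (hG : IsWeakGradient (Metric.ball 0 R) v G)
    (hvi : IntegrableOn v (Metric.ball 0 R)) (hGi : IntegrableOn G (Metric.ball 0 R)) :
    ∀ᵐ x ∂volume.restrict (Metric.ball (0 : Plane) R),
      ‖G ((Submodule.span ℝ {e})ᗮ.reflection x)‖ = ‖G x‖ := by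
  have h1 := hG.comp_linearIsometryEquiv Metric.isOpen_ball hvi hGi
    (Submodule.span ℝ {e})ᗮ.reflection (reflection_preimage_ball e R)
  have h2 : IsWeakGradient (Metric.ball 0 R) (fun x => -v x) (fun x => (-1 : ℝ) • G x) :=
    hG.comp Metric.isOpen_ball hvi hGi (F := fun s => -s) (F' := fun _ => -1)
      (fun s => hasDerivAt_neg s) continuous_const (L := 1) (fun s => by simp)
  filter_upwards [(h1.congr h (ae_eq_refl _)).ae_eq Metric.isOpen_ball h2] with x hx
  have := congrArg norm hx
  simpa using this

/-- A nonnegative integrand and its reflection have the same integral; if the two add up to at most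
`g`, then each of them has at most half of the integral of `g`. -/
theorem two_mul_lintegral_le_of_add_reflection_le {f g : Plane → ℝ≥0∞}
    (hf : AEMeasurable f (volume.restrict (Metric.ball (0 : Plane) R)))
    (hfg : ∀ᵐ x ∂volume.restrict (Metric.ball (0 : Plane) R),
      f x + f ((Submodule.span ℝ {e})ᗮ.reflection x) ≤ g x) :
    2 * ∫⁻ x in Metric.ball (0 : Plane) R, f x ≤ ∫⁻ x in Metric.ball (0 : Plane) R, g x := by
  have h1 := (measurePreserving_reflection_ball e R).lintegral_comp_emb
    (measurableEmbedding_reflection e) f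
  rw [two_mul]
  nth_rewrite 2 [← h1]
  rw [← lintegral_add_left' hf]
  exact lintegral_mono_ae hfg

theorem lintegral_le_two_mul_of_le_add_reflection {f g : Plane → ℝ≥0∞}
    (hf : AEMeasurable f (volume.restrict (Metric.ball (0 : Plane) R)))
    (hfg : ∀ᵐ x ∂volume.restrict (Metric.ball (0 : Plane) R),
      g x ≤ f x + f ((Submodule.span ℝ {e})ᗮ.reflection x)) :
    ∫⁻ x in Metric.ball (0 : Plane) R, g x ≤ 2 * ∫⁻ x in Metric.ball (0 : Plane) R, f x := by
  have h1 := (measurePreserving_reflection_ball e R).lintegral_comp_emb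
    (measurableEmbedding_reflection e) f
  rw [two_mul]
  nth_rewrite 2 [← h1]
  rw [← lintegral_add_left' hf]
  exact lintegral_mono_ae hfg

end Antisymmetric

/-! ### Comparison with a recentred positive part -/

/-- The effect on the weight of the energy of subtracting `m` and multiplying by `c`. -/
theorem sq_div_one_add_abs_rpow_le {a c c₀ m t : ℝ} (ha : 0 ≤ a) (ha1 : a ≤ 1) (hc : 0 < c)
    (hcc₀ : c ≤ c₀) (hc₀ : 1 ≤ c₀) (hm : 0 ≤ m) (ht : 0 ≤ t) :
    c ^ 2 / (1 + |c * (t - m)|) ^ a ≤ c₀ ^ 2 * (1 + m) / (1 + t) ^ a := by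
  rw [abs_mul, abs_of_pos hc]
  set d := |t - m|
  have hd : 0 ≤ d := abs_nonneg _
  have htd : t - m ≤ d := le_abs_self _
  have h1 : (1 + t) ^ a ≤ (1 + m) * (1 + d) ^ a := by
    calc (1 + t) ^ a ≤ ((1 + m) * (1 + d)) ^ a := by
          refine Real.rpow_le_rpow (by positivity) ?_ ha
          nlinarith [mul_nonneg hm hd]
      _ = (1 + m) ^ a * (1 + d) ^ a := Real.mul_rpow (by positivity) (by positivity)
      _ ≤ (1 + m) ^ (1 : ℝ) * (1 + d) ^ a := by
          gcongr
          linarith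
      _ = _ := by rw [Real.rpow_one]
  have h2 : c ^ 2 * (1 + d) ^ a ≤ c₀ ^ 2 * (1 + c * d) ^ a := by
    rcases le_total 1 c with h | h
    · gcongr
      nlinarith
    · have h3 : c ^ 2 ≤ c ^ a := by
        rw [← Real.rpow_two]
        exact Real.rpow_le_rpow_of_exponent_ge hc h (by linarith)
      calc c ^ 2 * (1 + d) ^ a ≤ c ^ a * (1 + d) ^ a := by gcongr
        _ = (c * (1 + d)) ^ a := (Real.mul_rpow hc.le (by positivity)).symm
        _ ≤ (1 + c * d) ^ a := Real.rpow_le_rpow (by positivity) (by linarith) ha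
        _ ≤ c₀ ^ 2 * (1 + c * d) ^ a := by
            refine le_mul_of_one_le_left (by positivity) ?_
            nlinarith
  rw [div_le_div_iff₀ (by positivity) (by positivity)]
  calc c ^ 2 * (1 + t) ^ a ≤ c ^ 2 * ((1 + m) * (1 + d) ^ a) := by gcongr
    _ = (c ^ 2 * (1 + d) ^ a) * (1 + m) := by ring
    _ ≤ (c₀ ^ 2 * (1 + c * d) ^ a) * (1 + m) := by gcongr
    _ = _ := by ring

theorem measurable_real_sign : Measurable Real.sign :=
  Measurable.ite measurableSet_Iio measurable_const
    (Measurable.ite measurableSet_Ioi measurable_const measurable_const)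

section

variable {R : ℝ} {e : Plane} {v : Plane → ℝ}

/-- The positive part of an antisymmetric function carries half of its energy. -/
theorem IsAntisymmetric.two_mul_lintegral_posPart_le
    (h : IsAntisymmetric (Metric.ball 0 R) e v) {G : Plane → Plane}
    (hG : IsWeakGradient (Metric.ball 0 R) v G) (hvi : IntegrableOn v (Metric.ball 0 R))
    (hGi : IntegrableOn G (Metric.ball 0 R)) (θ : ℝ) :
    2 * ∫⁻ x in Metric.ball (0 : Plane) R, ENNReal.ofReal
        (((1 + Real.sign (v x)) / 2) ^ 2 * (‖G x‖ ^ 2 / (1 + |v x|) ^ (2 * θ))) ≤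
      energy (Metric.ball 0 R) θ v := by
  rw [hG.energy_eq Metric.isOpen_ball]
  have hm : Measurable fun s : ℝ => ((1 + Real.sign s) / 2) ^ 2 := by
    have := measurable_real_sign
    fun_prop
  refine two_mul_lintegral_le_of_add_reflection_le (e := e) ?_ ?_
  · refine AEMeasurable.ennreal_ofReal ?_
    have hv := hvi.aestronglyMeasurable.aemeasurable
    have hg := hGi.aestronglyMeasurable.norm.aemeasurable
    exact (hm.comp_aemeasurable hv).mul
      ((hg.pow_const 2).div ((hv.abs.const_add 1).pow_const _))
  · filter_upwards [h, h.norm_grad_ae_eq hG hvi hGi] with x hx hgx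
    rw [hx, hgx, abs_neg]
    have hD : 0 ≤ ‖G x‖ ^ 2 / (1 + |v x|) ^ (2 * θ) := by positivity
    rw [← ENNReal.ofReal_add (by positivity) (by positivity), ← add_mul]
    refine ENNReal.ofReal_le_ofReal (mul_le_of_le_one_left hD ?_)
    rcases lt_trichotomy (v x) 0 with h0 | h0 | h0
    · rw [Real.sign_of_neg h0, Real.sign_of_pos (neg_pos.2 h0)]; norm_num
    · rw [h0]; norm_num
    · rw [Real.sign_of_pos h0, Real.sign_of_neg (neg_lt_zero.2 h0)]; norm_num

/-- The positive part of an antisymmetric function carries half of `∫ |v|^p`. -/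
theorem IsAntisymmetric.half_rpow_le_eLpNorm_posPart
    (h : IsAntisymmetric (Metric.ball 0 R) e v) (hvi : IntegrableOn v (Metric.ball 0 R)) {p : ℝ}
    (hp : 0 < p) (h1 : eLpNorm v (ENNReal.ofReal p) (volume.restrict (Metric.ball 0 R)) = 1) :
    (1 / 2 : ℝ≥0∞) ^ (1 / p) ≤ eLpNorm (fun x => max (v x) 0) (ENNReal.ofReal p)
      (volume.restrict (Metric.ball 0 R)) := by
  have hp0 : ENNReal.ofReal p ≠ 0 := by simpa using hp
  rw [eLpNorm_eq_lintegral_rpow_enorm_toReal hp0 ENNReal.ofReal_ne_top,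
    ENNReal.toReal_ofReal hp.le] at h1 ⊢
  have h1' : ∫⁻ x in Metric.ball (0 : Plane) R, ‖v x‖ₑ ^ p = 1 := by
    have := congrArg (fun t : ℝ≥0∞ => t ^ p) h1
    simpa [← ENNReal.rpow_mul, hp.ne'] using this
  gcongr
  have h2 := lintegral_le_two_mul_of_le_add_reflection (R := R) (e := e)
    (f := fun x => ‖max (v x) 0‖ₑ ^ p) (g := fun x => ‖v x‖ₑ ^ p)
    ((hvi.aestronglyMeasurable.sup aestronglyMeasurable_const).enorm.pow_const p) ?_
  · rw [h1'] at h2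
    rw [ENNReal.div_le_iff_le_mul (Or.inl (by norm_num)) (Or.inl (by norm_num)), mul_comm]
    exact h2
  · filter_upwards [h] with x hx
    rw [hx]
    rcases le_total 0 (v x) with h0 | h0
    · rw [max_eq_left h0]
      exact le_self_add
    · rw [max_eq_left (neg_nonneg.2 h0), enorm_neg]
      exact le_add_self

theorem Admissible.integrableOn {q p : ℝ} (hq : 1 ≤ q)
    (h : Admissible (Metric.ball 0 R) q p v) : IntegrableOn v (Metric.ball 0 R) := by
  have hq1 : 1 ≤ ENNReal.ofReal q := by
    rw [← ENNReal.ofReal_one]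
    exact ENNReal.ofReal_le_ofReal hq
  have : IsFiniteMeasure (volume.restrict (Metric.ball (0 : Plane) R)) :=
    isFiniteMeasure_restrict.2 measure_ball_lt_top.ne
  exact h.memW1.1.integrable hq1

/-- Subtracting its mean from the positive part of an antisymmetric function and normalising gives a
competitor with strictly less energy, provided that the mean `m` is small and `p` is large. -/
theorem IsAntisymmetric.lam_le {θ q p : ℝ} (hθ : 0 ≤ 2 * θ) (hθ' : 2 * θ ≤ 1) (hq : 1 ≤ q)
    (hp : 1 ≤ p) (hR : 0 < R)
    (h : IsAntisymmetric (Metric.ball 0 R) e v) (hv : Admissible (Metric.ball 0 R) q p v) {m : ℝ}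
    (hm : ∫ x in Metric.ball (0 : Plane) R, max (v x) 0 =
      m * volume.real (Metric.ball (0 : Plane) R))
    (hm0 : 0 ≤ m) (hm1 : m ≤ 1 / 20)
    (hp1 : ENNReal.ofReal (98 / 100) ≤ (1 / 2 : ℝ≥0∞) ^ (1 / p))
    (hp2 : volume (Metric.ball (0 : Plane) R) ^ (1 / p) ≤ ENNReal.ofReal (11 / 10)) :
    lam (Metric.ball 0 R) θ q p ≤ ENNReal.ofReal (3 / 4) * energy (Metric.ball 0 R) θ v := by
  set B := Metric.ball (0 : Plane) R
  have hμt : volume B ≠ ⊤ := measure_ball_lt_top.ne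
  have hμ0 : volume B ≠ 0 := (Metric.measure_ball_pos volume 0 hR).ne'
  have : IsFiniteMeasure (volume.restrict B) := isFiniteMeasure_restrict.2 hμt
  have hq1 : 1 ≤ ENNReal.ofReal q := by
    rw [← ENNReal.ofReal_one]
    exact ENNReal.ofReal_le_ofReal hq
  have hp1' : 1 ≤ ENNReal.ofReal p := by
    rw [← ENNReal.ofReal_one]
    exact ENNReal.ofReal_le_ofReal hp
  have hp0 : 0 < p := by linarith
  obtain ⟨hvq, ⟨G, hG⟩, hGq⟩ := hv.memW1
  replace hGq : MemLp G (ENNReal.ofReal q) (volume.restrict B) :=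
    hGq.ae_eq (hG.weakGrad_ae_eq Metric.isOpen_ball)
  have hvi : IntegrableOn v B := hvq.integrable hq1
  have hGi : IntegrableOn G B := hGq.integrable hq1
  have hvm : AEStronglyMeasurable v (volume.restrict B) := hvi.aestronglyMeasurable
  have hpos := hG.posPart Metric.isOpen_ball hvi hGi
  have hpm : AEStronglyMeasurable (fun x => max (v x) 0) (volume.restrict B) :=
    (hvm.sup aestronglyMeasurable_const)
  have hple : ∀ x, ‖max (v x) 0‖ ≤ ‖v x‖ := fun x => by
    rw [Real.norm_of_nonneg (le_max_right _ _)]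
    exact max_le (le_abs_self _) (abs_nonneg _)
  have hpi : IntegrableOn (fun x => max (v x) 0) B := Integrable.mono hvi hpm (Eventually.of_forall hple)
  have hpq : MemLp (fun x => max (v x) 0) (ENNReal.ofReal q) (volume.restrict B) :=
    hvq.mono hpm (Eventually.of_forall hple)
  have hvp : MemLp v (ENNReal.ofReal p) (volume.restrict B) :=
    ⟨hvm, by rw [hv.eLpNorm_eq_one]; exact ENNReal.one_lt_top⟩
  have hpp : MemLp (fun x => max (v x) 0) (ENNReal.ofReal p) (volume.restrict B) :=
    hvp.mono hpm (Eventually.of_forall hple)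
  -- The recentred function `u₀` and its norm `N`.
  set u₀ : Plane → ℝ := fun x => max (v x) 0 - m with hu₀
  have hu₀p : MemLp u₀ (ENNReal.ofReal p) (volume.restrict B) := hpp.sub (memLp_const m)
  set N := (eLpNorm u₀ (ENNReal.ofReal p) (volume.restrict B)).toReal with hN
  have hNe : eLpNorm u₀ (ENNReal.ofReal p) (volume.restrict B) = ENNReal.ofReal N :=
    (ENNReal.ofReal_toReal hu₀p.2.ne).symm
  have hN1 : 10 / 11 ≤ N := by
    have h1 : ENNReal.ofReal (98 / 100) ≤ ENNReal.ofReal N + ENNReal.ofReal (m * (11 / 10)) := by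
      calc ENNReal.ofReal (98 / 100) ≤ (1 / 2 : ℝ≥0∞) ^ (1 / p) := hp1
        _ ≤ eLpNorm (fun x => max (v x) 0) (ENNReal.ofReal p) (volume.restrict B) :=
            h.half_rpow_le_eLpNorm_posPart hvi hp0 hv.eLpNorm_eq_one
        _ = eLpNorm (u₀ + fun _ => m) (ENNReal.ofReal p) (volume.restrict B) := by
            congr 1
            funext x
            simp [hu₀]
        _ ≤ eLpNorm u₀ (ENNReal.ofReal p) (volume.restrict B) +
              eLpNorm (fun _ => m) (ENNReal.ofReal p) (volume.restrict B) :=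
            eLpNorm_add_le hu₀p.1 aestronglyMeasurable_const hp1'
        _ ≤ ENNReal.ofReal N + ENNReal.ofReal (m * (11 / 10)) := by
            rw [hNe, eLpNorm_const' _ (by simpa using hp0) ENNReal.ofReal_ne_top,
              ENNReal.toReal_ofReal hp0.le, Measure.restrict_apply_univ, ENNReal.ofReal_mul hm0,
              Real.enorm_of_nonneg hm0]
            gcongr
    rw [← ENNReal.ofReal_add ENNReal.toReal_nonneg (by positivity),
      ENNReal.ofReal_le_ofReal_iff (by positivity)] at h1
    linarith
  have hN0 : 0 < N := by linarith
  set c := N⁻¹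
  have hc0 : 0 < c := inv_pos.2 hN0
  have hc1 : c ≤ 11 / 10 := by
    calc c ≤ (10 / 11)⁻¹ := by
          simp only [c]
          gcongr
      _ = 11 / 10 := by norm_num
  have hs1 : ∀ s : ℝ, ‖(1 + Real.sign s) / 2‖ ≤ 1 := by
    intro s
    rcases Real.sign_apply_eq s with h | h | h <;> rw [h] <;> norm_num
  have hGm : AEStronglyMeasurable (fun x => ((1 + Real.sign (v x)) / 2) • G x)
      (volume.restrict B) :=
    (((measurable_real_sign.comp_aemeasurable hvm.aemeasurable).const_add 1).div_const
      2).aestronglyMeasurable.smul hGi.aestronglyMeasurable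
  have hGle : ∀ x, ‖((1 + Real.sign (v x)) / 2) • G x‖ ≤ ‖G x‖ := fun x => by
    rw [norm_smul]
    exact mul_le_of_le_one_left (norm_nonneg _) (hs1 _)
  have hgrad : IsWeakGradient B (fun x => c * u₀ x)
      (fun x => c • ((1 + Real.sign (v x)) / 2) • G x) := by
    have hposi : IntegrableOn (fun x => ((1 + Real.sign (v x)) / 2) • G x) B :=
      Integrable.mono hGi hGm (Eventually.of_forall hGle)
    exact hpos.comp Metric.isOpen_ball hpi hposi (F := fun s => c * (s - m)) (F' := fun _ => c)
      (fun s => by simpa using ((hasDerivAt_id s).sub_const m).const_mul c) continuous_const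
      (L := |c|) (fun s => le_rfl)
  have hadm : Admissible B q p fun x => c * u₀ x := by
    have hnorm : eLpNorm (fun x => c * u₀ x) (ENNReal.ofReal p) (volume.restrict B) = 1 := by
      have h1 := eLpNorm_const_smul c u₀ (ENNReal.ofReal p) (volume.restrict B)
      rw [hNe, Real.enorm_of_nonneg hc0.le, ← ENNReal.ofReal_mul hc0.le,
        inv_mul_cancel₀ hN0.ne', ENNReal.ofReal_one] at h1
      exact h1
    refine ⟨hgrad.memW1 Metric.isOpen_ball ((hpq.sub (memLp_const m)).const_mul c) ?_, ?_, ?_,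
      hnorm⟩
    · exact (hGq.mono hGm (Eventually.of_forall hGle)).const_smul c
    · intro h0
      rw [eLpNorm_congr_ae h0, eLpNorm_zero] at hnorm
      exact zero_ne_one hnorm
    · rw [integral_const_mul, integral_sub hpi (integrable_const _), hm, setIntegral_const,
        smul_eq_mul, mul_comm m, sub_self, mul_zero]
  -- Where `v < 0` the gradient of the competitor vanishes, so only the weight at `v ≥ 0` matters.
  have hen : energy B θ (fun x => c * u₀ x) ≤ ENNReal.ofReal ((11 / 10) ^ 2 * (1 + 1 / 20)) *
      ∫⁻ x in B, ENNReal.ofReal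
        (((1 + Real.sign (v x)) / 2) ^ 2 * (‖G x‖ ^ 2 / (1 + |v x|) ^ (2 * θ))) := by
    rw [hgrad.energy_eq Metric.isOpen_ball, ← lintegral_const_mul' _ _ ENNReal.ofReal_ne_top]
    refine lintegral_mono fun x => ?_
    rw [← ENNReal.ofReal_mul (by positivity)]
    refine ENNReal.ofReal_le_ofReal ?_
    rw [norm_smul, norm_smul, mul_pow, mul_pow, Real.norm_eq_abs, Real.norm_eq_abs, sq_abs, sq_abs]
    rcases lt_or_ge (v x) 0 with hx | hx
    · rw [Real.sign_of_neg hx]; norm_num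
    · have hw := sq_div_one_add_abs_rpow_le hθ hθ' hc0 hc1 (by norm_num) hm0 hx
      simp only [hu₀]
      rw [max_eq_left hx, abs_of_nonneg hx]
      calc c ^ 2 * (((1 + Real.sign (v x)) / 2) ^ 2 * ‖G x‖ ^ 2) /
              (1 + |c * (v x - m)|) ^ (2 * θ)
          = (((1 + Real.sign (v x)) / 2) ^ 2 * ‖G x‖ ^ 2) *
              (c ^ 2 / (1 + |c * (v x - m)|) ^ (2 * θ)) := by ring
        _ ≤ (((1 + Real.sign (v x)) / 2) ^ 2 * ‖G x‖ ^ 2) *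
              ((11 / 10) ^ 2 * (1 + m) / (1 + v x) ^ (2 * θ)) := by gcongr
        _ ≤ (((1 + Real.sign (v x)) / 2) ^ 2 * ‖G x‖ ^ 2) *
              ((11 / 10) ^ 2 * (1 + 1 / 20) / (1 + v x) ^ (2 * θ)) := by gcongr
        _ = _ := by ring
  calc lam B θ q p ≤ energy B θ (fun x => c * u₀ x) := sInf_le ⟨_, hadm, rfl⟩
    _ ≤ _ := hen
    _ ≤ ENNReal.ofReal (3 / 4) * (2 * ∫⁻ x in B, ENNReal.ofReal
        (((1 + Real.sign (v x)) / 2) ^ 2 * (‖G x‖ ^ 2 / (1 + |v x|) ^ (2 * θ)))) := by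
        rw [← mul_assoc]
        gcongr
        rw [show (2 : ℝ≥0∞) = ENNReal.ofReal 2 by simp, ← ENNReal.ofReal_mul (by norm_num)]
        exact ENNReal.ofReal_le_ofReal (by norm_num)
    _ ≤ _ := by
        gcongr
        exact h.two_mul_lintegral_posPart_le hG hvi hGi θ

end

/-! ### Antisymmetric functions of small energy -/

theorem ENNReal.tendsto_rpow_one_div_atTop {a : ℝ≥0∞} (h0 : a ≠ 0) (ht : a ≠ ⊤) :
    Tendsto (fun p : ℝ => a ^ (1 / p)) atTop (𝓝 1) := by
  have ha : 0 < a.toReal := ENNReal.toReal_pos h0 ht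
  have h1 : Tendsto (fun p : ℝ => a.toReal ^ (1 / p)) atTop (𝓝 1) := by
    have h2 : Tendsto (fun p : ℝ => 1 / p) atTop (𝓝 0) := tendsto_const_nhds.div_atTop tendsto_id
    have h4 := ((Real.continuous_const_rpow ha.ne').tendsto 0).comp h2
    rwa [Real.rpow_zero] at h4
  have h3 := (ENNReal.continuous_ofReal.tendsto 1).comp h1
  rw [ENNReal.ofReal_one] at h3
  refine h3.congr fun p => ?_
  rw [Function.comp_apply, ← ENNReal.ofReal_rpow_of_pos ha, ENNReal.ofReal_toReal ht]

/-- The regularisation `(|y|² + ε)^{s/2}` of the power `|y|^s`. -/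
noncomputable def regPow (s ε : ℝ) (y : Plane) : ℝ := (‖y‖ ^ 2 + ε) ^ (s / 2)

theorem contDiff_regPow (s : ℝ) {ε : ℝ} (hε : 0 < ε) : ContDiff ℝ ∞ (regPow s ε) := by
  unfold regPow
  exact ((contDiff_norm_sq ℝ).add contDiff_const).rpow_const_of_ne fun y => by positivity

theorem norm_fderiv_regPow_le {s ε : ℝ} (hs : 0 < s) (hs1 : s < 1) (hε : 0 < ε) {y : Plane}
    (hy : y ≠ 0) : ‖fderiv ℝ (regPow s ε) y‖ ≤ s * ‖y‖ ^ (s - 1) := by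
  have hy0 : 0 < ‖y‖ := norm_pos_iff.2 hy
  have hpos : 0 < ‖y‖ ^ 2 + ε := by positivity
  have h1 : HasFDerivAt (fun y : Plane => ‖y‖ ^ 2 + ε) (2 • innerSL ℝ y) y :=
    (hasStrictFDerivAt_norm_sq y).hasFDerivAt.add_const ε
  have h2 : HasFDerivAt (regPow s ε)
      ((s / 2 * (‖y‖ ^ 2 + ε) ^ (s / 2 - 1)) • (2 • innerSL ℝ y)) y := by
    have h3 : HasDerivAt (fun t : ℝ => t ^ (s / 2)) (s / 2 * (‖y‖ ^ 2 + ε) ^ (s / 2 - 1))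
        (‖y‖ ^ 2 + ε) := Real.hasDerivAt_rpow_const (Or.inl hpos.ne')
    exact h3.comp_hasFDerivAt y h1
  rw [h2.fderiv, norm_smul, two_smul, ← two_smul ℝ, norm_smul, innerSL_apply_norm,
    Real.norm_of_nonneg (by positivity), Real.norm_of_nonneg (by norm_num)]
  have h3 : (‖y‖ ^ 2 + ε) ^ (s / 2 - 1) ≤ (‖y‖ ^ 2) ^ (s / 2 - 1) :=
    Real.rpow_le_rpow_of_nonpos (by positivity) (by linarith) (by linarith)
  have h4 : (‖y‖ ^ 2) ^ (s / 2 - 1) * ‖y‖ = ‖y‖ ^ (s - 1) := by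
    rw [← Real.rpow_natCast ‖y‖ 2, ← Real.rpow_mul hy0.le]
    nth_rewrite 2 [← Real.rpow_one ‖y‖]
    rw [← Real.rpow_add hy0]
    congr 1
    push_cast
    ring
  calc s / 2 * (‖y‖ ^ 2 + ε) ^ (s / 2 - 1) * (2 * ‖y‖)
      ≤ s / 2 * (‖y‖ ^ 2) ^ (s / 2 - 1) * (2 * ‖y‖) := by gcongr
    _ = s * ((‖y‖ ^ 2) ^ (s / 2 - 1) * ‖y‖) := by ring
    _ = _ := by rw [h4]

theorem enorm_fderiv_regPow_sq_le {s ε : ℝ} (hs : 0 < s) (hs1 : s < 1) (hε : 0 < ε) {y : Plane}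
    (hy : y ≠ 0) :
    ‖fderiv ℝ (regPow s ε) y‖ₑ ^ 2 ≤ ENNReal.ofReal (s ^ 2) * ‖y‖ₑ ^ (-(2 - 2 * s)) := by
  have hy0 : 0 < ‖y‖ := norm_pos_iff.2 hy
  rw [← ofReal_norm, ← ofReal_norm, ENNReal.ofReal_rpow_of_pos hy0,
    ← ENNReal.ofReal_mul (by positivity), ← ENNReal.ofReal_pow (norm_nonneg _)]
  refine ENNReal.ofReal_le_ofReal ?_
  calc _ ≤ (s * ‖y‖ ^ (s - 1)) ^ 2 := by
        gcongr
        exact norm_fderiv_regPow_le hs hs1 hε hy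
    _ = _ := by
        rw [mul_pow, ← Real.rpow_natCast (‖y‖ ^ (s - 1)), ← Real.rpow_mul hy0.le]
        congr 2
        push_cast
        ring

theorem enorm_sub_sq_le {E : Type*} [NormedAddCommGroup E] (a b : E) :
    ‖a - b‖ₑ ^ 2 ≤ 2 * (‖a‖ₑ ^ 2 + ‖b‖ₑ ^ 2) := by
  simp only [← ofReal_norm, ← ENNReal.ofReal_pow (norm_nonneg _)]
  rw [← ENNReal.ofReal_add (by positivity) (by positivity), ← ENNReal.ofReal_ofNat 2,
    ← ENNReal.ofReal_mul (by norm_num)]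
  refine ENNReal.ofReal_le_ofReal ?_
  nlinarith [sq_nonneg (‖a‖ - ‖b‖), norm_sub_le a b, norm_nonneg (a - b)]

/-- Points have zero capacity in the plane: there are smooth antisymmetric functions with arbitrarily
small Dirichlet integral and a value at least `1/2`. They are differences of two translates of
`(|y|² + ε)^{s/2}` with `s → 0` and `ε = ε(s) → 0`. -/
theorem exists_contDiff_antisymmetric_dirichlet_le {R : ℝ} (hR : 0 < R) {η : ℝ≥0∞} (hη : η ≠ 0) :
    ∃ f : Plane → ℝ, ContDiff ℝ ∞ f ∧
      (∀ x, f ((Submodule.span ℝ {e₂})ᗮ.reflection x) = - f x) ∧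
      (∃ a ∈ Metric.ball (0 : Plane) R, 1 / 2 ≤ f a) ∧
      ∫⁻ x in Metric.ball (0 : Plane) R, ‖fderiv ℝ f x‖ₑ ^ 2 ≤ η := by
  set B := Metric.ball (0 : Plane) R
  set κ := volume.real (Metric.ball (0 : Plane) 1)
  obtain ⟨s, ⟨hs1, hsR, hsη⟩, hs⟩ : ∃ s : ℝ, (s < 1 ∧ 3 / 4 ≤ R ^ s ∧
      ENNReal.ofReal (4 * s ^ 2 * (2 * (κ * ((2 * R) ^ (2 * s) / (2 * s))))) ≤ η) ∧ 0 < s := by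
    have h1 : ∀ᶠ s : ℝ in 𝓝[>] 0, s < 1 := nhdsWithin_le_nhds (gt_mem_nhds one_pos)
    have h2 : ∀ᶠ s : ℝ in 𝓝[>] 0, 3 / 4 ≤ R ^ s := by
      have h3 := (Real.continuous_const_rpow hR.ne').tendsto 0
      rw [Real.rpow_zero] at h3
      exact nhdsWithin_le_nhds ((h3.eventually (lt_mem_nhds (by norm_num))).mono fun s h => le_of_lt h)
    have h3 : ∀ᶠ s : ℝ in 𝓝[>] 0,
        ENNReal.ofReal (4 * s ^ 2 * (2 * (κ * ((2 * R) ^ (2 * s) / (2 * s))))) ≤ η := by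
      have h4 : Tendsto (fun s : ℝ => ENNReal.ofReal (4 * s * (κ * (2 * R) ^ (2 * s)))) (𝓝 0)
          (𝓝 0) := by
        have h5 : Continuous fun s : ℝ => 4 * s * (κ * (2 * R) ^ (2 * s)) := by
          have : Continuous fun s : ℝ => (2 * R) ^ (2 * s) :=
            (Real.continuous_const_rpow (by positivity)).comp (by fun_prop)
          fun_prop
        have h6 := (ENNReal.continuous_ofReal.comp h5).tendsto 0
        have h7 : ENNReal.ofReal (4 * 0 * (κ * (2 * R) ^ (2 * (0 : ℝ)))) = 0 := by simp
        rw [Function.comp_apply, h7] at h6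
        exact h6
      filter_upwards [nhdsWithin_le_nhds (ENNReal.tendsto_nhds_zero.1 h4 η (pos_iff_ne_zero.2 hη)),
        self_mem_nhdsWithin] with s hs hs0
      refine le_trans (le_of_eq ?_) hs
      have : s ≠ 0 := ne_of_gt hs0
      congr 1
      field_simp
    exact ((h1.and (h2.and h3)).and self_mem_nhdsWithin).exists
  obtain ⟨ε, hε4, hε⟩ : ∃ ε : ℝ, ε ^ (s / 2) ≤ 1 / 4 ∧ 0 < ε := by
    have h1 := (Real.continuousAt_rpow_const 0 (s / 2) (Or.inr (by positivity))).tendsto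
    rw [Real.zero_rpow (by positivity)] at h1
    have h2 : ∀ᶠ ε : ℝ in 𝓝[>] 0, ε ^ (s / 2) ≤ 1 / 4 :=
      nhdsWithin_le_nhds ((h1.eventually (gt_mem_nhds (by norm_num))).mono fun s h => le_of_lt h)
    exact (h2.and self_mem_nhdsWithin).exists
  set a : Plane := (R / 2) • e₂ with ha
  have hna : ‖a‖ = R / 2 := by
    rw [ha, norm_smul, Real.norm_of_nonneg (by positivity), e₂, EuclideanSpace.single, PiLp.norm_single]
    simp
  have haB : a ∈ B := by
    rw [mem_ball_zero_iff, hna]; linarith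
  have hnaB : -a ∈ B := by
    rw [mem_ball_zero_iff, norm_neg, hna]; linarith
  have hg := contDiff_regPow s hε
  refine ⟨fun x => regPow s ε (x + a) - regPow s ε (x - a), ?_, ?_, ⟨a, haB, ?_⟩, ?_⟩
  · exact (hg.comp (contDiff_id.add contDiff_const)).sub
      (hg.comp (contDiff_id.sub contDiff_const))
  · intro x
    set σ := (Submodule.span ℝ {e₂})ᗮ.reflection
    have hσa : σ a = -a := by
      rw [ha, map_smul, Submodule.reflection_orthogonalComplement_singleton_eq_neg, smul_neg]
    have h1 : ‖σ x + a‖ = ‖x - a‖ := by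
      rw [← σ.norm_map (x - a), map_sub, hσa, sub_neg_eq_add]
    have h2 : ‖σ x - a‖ = ‖x + a‖ := by
      rw [← σ.norm_map (x + a), map_add, hσa, sub_eq_add_neg]
    simp only [regPow, h1, h2]
    ring
  · have h1 : R ^ s ≤ (‖a + a‖ ^ 2 + ε) ^ (s / 2) := by
      have h2 : ‖a + a‖ = R := by
        rw [← two_smul ℝ, norm_smul, hna, Real.norm_of_nonneg (by norm_num)]; ring
      rw [h2]
      calc R ^ s = (R ^ 2) ^ (s / 2) := by
            rw [← Real.rpow_natCast R 2, ← Real.rpow_mul hR.le]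
            congr 1
            push_cast
            ring
        _ ≤ _ := Real.rpow_le_rpow (by positivity) (by linarith) (by positivity)
    have h3 : regPow s ε (a - a) = ε ^ (s / 2) := by simp [regPow]
    have h4 : regPow s ε (a + a) = (‖a + a‖ ^ 2 + ε) ^ (s / 2) := rfl
    beta_reduce
    rw [h3, h4]
    linarith
  · have hd : ∀ x, fderiv ℝ (fun x => regPow s ε (x + a) - regPow s ε (x - a)) x =
        fderiv ℝ (regPow s ε) (x + a) - fderiv ℝ (regPow s ε) (x - a) := by
      intro x
      have hdiff : Differentiable ℝ (regPow s ε) := hg.differentiable (by simp)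
      have h1 : DifferentiableAt ℝ (fun x => regPow s ε (x + a)) x := by fun_prop
      have h2 : DifferentiableAt ℝ (fun x => regPow s ε (x - a)) x := by fun_prop
      rw [fderiv_fun_sub h1 h2, fderiv_comp_add_right, fderiv_comp_sub]
    set Q : Plane → ℝ≥0∞ := fun y => ‖y‖ₑ ^ (-(2 - 2 * s)) with hQ
    have hQm : Measurable Q := by fun_prop
    set K := ∫⁻ y in Metric.ball (0 : Plane) (2 * R), ‖y‖ₑ ^ (-(2 - 2 * s)) with hK
    calc ∫⁻ x in B, ‖fderiv ℝ (fun x => regPow s ε (x + a) - regPow s ε (x - a)) x‖ₑ ^ 2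
        ≤ ∫⁻ x in B, 2 * ENNReal.ofReal (s ^ 2) * (Q (x - -a) + Q (x - a)) := by
          refine lintegral_mono_ae (ae_restrict_of_ae ?_)
          filter_upwards [Measure.ae_ne volume a, Measure.ae_ne volume (-a)] with x hx1 hx2
          have e1 := enorm_fderiv_regPow_sq_le hs hs1 hε (y := x + a)
            (fun h => hx2 (eq_neg_of_add_eq_zero_left h))
          have e2 := enorm_fderiv_regPow_sq_le hs hs1 hε (y := x - a) (sub_ne_zero.2 hx1)
          rw [hd, sub_neg_eq_add]
          refine (enorm_sub_sq_le _ _).trans ?_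
          rw [mul_assoc, mul_add (ENNReal.ofReal (s ^ 2))]
          gcongr
      _ = 2 * ENNReal.ofReal (s ^ 2) * ((∫⁻ x in B, Q (x - -a)) + ∫⁻ x in B, Q (x - a)) := by
          rw [lintegral_const_mul _ (by fun_prop), lintegral_add_left (by fun_prop)]
      _ ≤ 2 * ENNReal.ofReal (s ^ 2) * (K + K) := by
          gcongr
          · exact setLIntegral_enorm_sub_rpow_neg_le hnaB
          · exact setLIntegral_enorm_sub_rpow_neg_le haB
      _ = ENNReal.ofReal (4 * s ^ 2 * (2 * (κ * ((2 * R) ^ (2 * s) / (2 * s))))) := by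
          rw [hK, lintegral_ball_enorm_rpow_neg (by linarith) (by positivity),
            show 2 - (2 - 2 * s) = 2 * s by ring, ← two_mul, ← mul_assoc,
            ENNReal.ofReal_mul (p := 4 * s ^ 2) (by positivity),
            ENNReal.ofReal_mul (p := 4) (by norm_num)]
          congr 1
          rw [mul_right_comm]
          congr 1
          norm_num
      _ ≤ η := hsη

/-- The antisymmetric infimum tends to zero as `p → ∞`: the norm `‖f‖_p` of a fixed function with a
value at least `1/2` exceeds `1/4` for large `p`, so normalising multiplies its energy by at most
`16`. -/
theorem exists_forall_lamAs_lt {R θ q : ℝ} (hR : 0 < R) (hθ : 0 ≤ 2 * θ) {η : ℝ≥0∞} (hη : η ≠ 0) :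
    ∃ p₁ : ℝ, ∀ p, p₁ < p → lamAs (Metric.ball 0 R) θ q p < η := by
  obtain ⟨η', hη'0, hη'⟩ : ∃ η' : ℝ≥0∞, η' ≠ 0 ∧ 16 * η' < η := by
    have h1 : Tendsto (fun t : ℝ≥0∞ => 16 * t) (𝓝[>] 0) (𝓝 0) := by
      have := (ENNReal.continuous_const_mul (a := 16) (by norm_num)).tendsto 0
      rw [mul_zero] at this
      exact this.mono_left nhdsWithin_le_nhds
    obtain ⟨t, ht, ht0⟩ := ((h1.eventually (gt_mem_nhds (pos_iff_ne_zero.2 hη))).and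
      self_mem_nhdsWithin).exists
    exact ⟨t, ne_of_gt ht0, ht⟩
  obtain ⟨f, hf, hfa, ⟨a, haB, ha⟩, hfη⟩ := exists_contDiff_antisymmetric_dirichlet_le hR hη'0
  set B := Metric.ball (0 : Plane) R
  have hμt : volume B ≠ ⊤ := measure_ball_lt_top.ne
  have : IsFiniteMeasure (volume.restrict B) := isFiniteMeasure_restrict.2 hμt
  set S := B ∩ f ⁻¹' Set.Ioi (3 / 8)
  have hSo : IsOpen S := Metric.isOpen_ball.inter (isOpen_Ioi.preimage hf.continuous)
  have hSpos : volume S ≠ 0 :=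
    (hSo.measure_pos volume ⟨a, haB, by simp only [Set.mem_preimage, Set.mem_Ioi]; linarith⟩).ne'
  have hSt : volume S ≠ ⊤ := measure_ne_top_of_subset Set.inter_subset_left hμt
  obtain ⟨p₁, hp₁⟩ := eventually_atTop.1 ((ENNReal.tendsto_rpow_one_div_atTop hSpos hSt).eventually
    (lt_mem_nhds (show ENNReal.ofReal (2 / 3) < 1 by
      rw [ENNReal.ofReal_lt_one]; norm_num)))
  refine ⟨max p₁ 1, fun p hp => ?_⟩
  have hpp₁ : p₁ ≤ p := (le_max_left _ _).trans hp.le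
  have hp1 : 1 < p := (le_max_right _ _).trans_lt hp
  have hp0 : ENNReal.ofReal p ≠ 0 := by
    have : 0 < p := by linarith
    simpa using this
  have hbdd : ∀ {E : Type} [NormedAddCommGroup E] {k : Plane → E} (r : ℝ≥0∞),
      Continuous k → MemLp k r (volume.restrict B) := by
    intro E _ k r hk
    obtain ⟨C, hC⟩ := ((isCompact_closedBall (0 : Plane) R).image hk.norm).isBounded.subset_closedBall 0
    refine MemLp.of_bound hk.aestronglyMeasurable C ?_
    filter_upwards [ae_restrict_mem measurableSet_ball] with x hx
    have := hC ⟨x, Metric.ball_subset_closedBall hx, rfl⟩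
    simpa using this
  set N := (eLpNorm f (ENNReal.ofReal p) (volume.restrict B)).toReal
  have hNe : eLpNorm f (ENNReal.ofReal p) (volume.restrict B) = ENNReal.ofReal N :=
    (ENNReal.ofReal_toReal (hbdd _ hf.continuous).2.ne).symm
  have hN4 : 1 / 4 ≤ N := by
    have h1 : ENNReal.ofReal (1 / 4) ≤ eLpNorm f (ENNReal.ofReal p) (volume.restrict B) := by
      calc ENNReal.ofReal (1 / 4) = ENNReal.ofReal (3 / 8) * ENNReal.ofReal (2 / 3) := by
            rw [← ENNReal.ofReal_mul (by norm_num)]; norm_num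
        _ ≤ ENNReal.ofReal (3 / 8) * volume S ^ (1 / p) := by
            gcongr
            exact (hp₁ p hpp₁).le
        _ = eLpNorm (S.indicator fun _ => (3 / 8 : ℝ)) (ENNReal.ofReal p) (volume.restrict B) := by
            rw [eLpNorm_indicator_const hSo.measurableSet hp0 ENNReal.ofReal_ne_top,
              ENNReal.toReal_ofReal (by linarith), Real.enorm_of_nonneg (by norm_num),
              Measure.restrict_apply hSo.measurableSet,
              Set.inter_eq_left.2 (Set.inter_subset_left : S ⊆ B)]
        _ ≤ eLpNorm f (ENNReal.ofReal p) (volume.restrict B) := by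
            refine eLpNorm_mono fun x => ?_
            by_cases hx : x ∈ S
            · rw [Set.indicator_of_mem hx, Real.norm_of_nonneg (by norm_num)]
              exact (le_of_lt hx.2).trans (le_abs_self _)
            · rw [Set.indicator_of_notMem hx, norm_zero]
              exact norm_nonneg _
    rwa [hNe, ENNReal.ofReal_le_ofReal_iff ENNReal.toReal_nonneg] at h1
  have hN0 : 0 < N := by linarith
  set c := N⁻¹
  have hc0 : 0 < c := inv_pos.2 hN0
  have hc4 : c ≤ 4 := by
    calc c ≤ (1 / 4)⁻¹ := by
          simp only [c]
          gcongr
      _ = 4 := by norm_num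
  have hv : ContDiff ℝ ∞ fun x => c * f x := contDiff_const.mul hf
  have hgrad : IsWeakGradient B (fun x => c * f x) (gradient fun x => c * f x) :=
    isWeakGradient_gradient (hv.of_le (by simp))
  have hgc : Continuous (gradient fun x => c * f x) :=
    (InnerProductSpace.toDual ℝ Plane).symm.continuous.comp (hv.continuous_fderiv (by simp))
  have hasym : IsAntisymmetric B e₂ fun x => c * f x :=
    Eventually.of_forall fun x => by
      beta_reduce
      rw [hfa]
      ring
  have hadm : Admissible B q p fun x => c * f x := by
    have hnorm : eLpNorm (fun x => c * f x) (ENNReal.ofReal p) (volume.restrict B) = 1 := by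
      have h1 := eLpNorm_const_smul c f (ENNReal.ofReal p) (volume.restrict B)
      rw [hNe, Real.enorm_of_nonneg hc0.le, ← ENNReal.ofReal_mul hc0.le,
        inv_mul_cancel₀ hN0.ne', ENNReal.ofReal_one] at h1
      exact h1
    refine ⟨hgrad.memW1 Metric.isOpen_ball (hbdd _ hv.continuous) (hbdd _ hgc), fun h0 => ?_,
      hasym.integral_comp_eq_zero (F := id) fun s => rfl, hnorm⟩
    rw [eLpNorm_congr_ae h0, eLpNorm_zero] at hnorm
    exact zero_ne_one hnorm
  refine lt_of_le_of_lt (sInf_le ⟨_, hadm, hasym, rfl⟩) ?_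
  refine lt_of_le_of_lt ?_ hη'
  calc energy B θ (fun x => c * f x)
      ≤ ∫⁻ x in B, 16 * ‖fderiv ℝ f x‖ₑ ^ 2 := by
        rw [hgrad.energy_eq Metric.isOpen_ball]
        refine lintegral_mono fun x => ?_
        have h1 : ‖gradient (fun x => c * f x) x‖ = c * ‖fderiv ℝ f x‖ := by
          rw [gradient, LinearIsometryEquiv.norm_map, fderiv_const_mul
            (hf.differentiable (by simp) x), norm_smul, Real.norm_of_nonneg hc0.le]
        have h2 : 1 ≤ (1 + |c * f x|) ^ (2 * θ) :=
          Real.one_le_rpow (by linarith [abs_nonneg (c * f x)]) hθ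
        rw [h1, ← ofReal_norm, ← ENNReal.ofReal_pow (norm_nonneg _), ← ENNReal.ofReal_ofNat 16,
          ← ENNReal.ofReal_mul (by norm_num)]
        refine ENNReal.ofReal_le_ofReal ((div_le_self (by positivity) h2).trans ?_)
        rw [mul_pow]
        gcongr
        nlinarith
    _ = 16 * ∫⁻ x in B, ‖fderiv ℝ f x‖ₑ ^ 2 := lintegral_const_mul' _ _ (by norm_num)
    _ ≤ 16 * η' := by gcongr

/-! ### Strict inequality and asymmetry of minimizers -/

theorem ENNReal.exists_pos_forall_mul_sqrt_add_lt {C ε : ℝ≥0∞} (hC : C ≠ ⊤) (hε : ε ≠ 0) :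
    ∃ η : ℝ≥0∞, η ≠ 0 ∧ ∀ E, E ≤ η → C * (E ^ (1 / 2 : ℝ) + E) < ε := by
  have hc : Continuous fun E : ℝ≥0∞ => C * (E ^ (1 / 2 : ℝ) + E) :=
    (ENNReal.continuous_const_mul hC).comp (ENNReal.continuous_rpow_const.add continuous_id)
  have h1 := hc.tendsto 0
  rw [ENNReal.zero_rpow_of_pos (by norm_num), add_zero, mul_zero] at h1
  obtain ⟨η, hη, hη0⟩ := (((h1.mono_left nhdsWithin_le_nhds).eventually
    (gt_mem_nhds (pos_iff_ne_zero.2 hε))).and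
      (self_mem_nhdsWithin : ∀ᶠ E in 𝓝[>] (0 : ℝ≥0∞), E ∈ Set.Ioi 0)).exists
  refine ⟨η, ne_of_gt hη0, fun E hE => lt_of_le_of_lt ?_ hη⟩
  gcongr

/-- The energy controls every `L^p` norm of antisymmetric functions; the constant does not depend on
the line of antisymmetry. -/
theorem IsAntisymmetric.eLpNorm_le_energy {R θ p : ℝ} (hR : 0 < R) (hθ : 2 * θ ≤ 1) (hp : 2 ≤ p) :
    ∃ C : ℝ≥0∞, C ≠ ⊤ ∧ ∀ {q r : ℝ} {e : Plane} {v : Plane → ℝ}, 1 ≤ q →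
      Admissible (Metric.ball 0 R) q r v → IsAntisymmetric (Metric.ball 0 R) e v →
      eLpNorm v (ENNReal.ofReal p) (volume.restrict (Metric.ball 0 R)) ≤
        C * (energy (Metric.ball 0 R) θ v ^ (1 / 2 : ℝ) + energy (Metric.ball 0 R) θ v) := by
  obtain ⟨C, hC, h⟩ := exists_eLpNorm_le_energy hR hθ hp
  refine ⟨C, hC, fun {q r e v} hq hv ha => ?_⟩
  have hq1 : 1 ≤ ENNReal.ofReal q := by
    rw [← ENNReal.ofReal_one]
    exact ENNReal.ofReal_le_ofReal hq
  have : IsFiniteMeasure (volume.restrict (Metric.ball (0 : Plane) R)) :=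
    isFiniteMeasure_restrict.2 measure_ball_lt_top.ne
  obtain ⟨hvq, ⟨G, hG⟩, hGq⟩ := hv.memW1
  exact h v G hG (hvq.integrable hq1)
    ((hGq.ae_eq (hG.weakGrad_ae_eq Metric.isOpen_ball)).integrable hq1)
    (ha.integral_comp_eq_zero flatten_neg)

/-- The energy of the antisymmetric admissible functions is bounded away from zero. -/
theorem exists_pos_le_energy_of_isAntisymmetric {R θ q p : ℝ} (hR : 0 < R) (hθ : 2 * θ ≤ 1)
    (hq : 1 ≤ q) (hp : 2 ≤ p) :
    ∃ c : ℝ≥0∞, c ≠ 0 ∧ ∀ (e : Plane) (v : Plane → ℝ), Admissible (Metric.ball 0 R) q p v →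
      IsAntisymmetric (Metric.ball 0 R) e v → c ≤ energy (Metric.ball 0 R) θ v := by
  obtain ⟨C, hC, h⟩ := IsAntisymmetric.eLpNorm_le_energy hR hθ hp
  obtain ⟨c, hc, hlt⟩ := ENNReal.exists_pos_forall_mul_sqrt_add_lt hC one_ne_zero
  refine ⟨c, hc, fun e v hv ha => ?_⟩
  by_contra! hcon
  have h1 := (h hq hv ha).trans_lt (hlt _ hcon.le)
  rw [hv.eLpNorm_eq_one] at h1
  exact lt_irrefl _ h1

/-- For antisymmetric functions of small energy the positive part has small mean. -/
theorem exists_forall_mean_posPart_le {R θ q : ℝ} (hR : 0 < R) (hθ : 2 * θ ≤ 1) (hq : 1 ≤ q) :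
    ∃ η : ℝ≥0∞, η ≠ 0 ∧ ∀ (p : ℝ) (e : Plane) (v : Plane → ℝ),
      Admissible (Metric.ball 0 R) q p v → IsAntisymmetric (Metric.ball 0 R) e v →
      energy (Metric.ball 0 R) θ v ≤ η →
      ∫ x in Metric.ball (0 : Plane) R, max (v x) 0 ≤
        1 / 20 * volume.real (Metric.ball (0 : Plane) R) := by
  obtain ⟨C, hC, h⟩ := IsAntisymmetric.eLpNorm_le_energy hR hθ (le_refl 2)
  set B := Metric.ball (0 : Plane) R
  have hμt : volume B ≠ ⊤ := measure_ball_lt_top.ne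
  have hμ0 : volume B ≠ 0 := (Metric.measure_ball_pos volume 0 hR).ne'
  have hμr : 0 < volume.real B := ENNReal.toReal_pos hμ0 hμt
  set M := volume B ^ (1 / 2 : ℝ)
  have hM : M ≠ ⊤ := ENNReal.rpow_ne_top_of_nonneg (by norm_num) hμt
  obtain ⟨η, hη, hlt⟩ := ENNReal.exists_pos_forall_mul_sqrt_add_lt (C := C * M)
    (ENNReal.mul_ne_top hC hM) (ε := ENNReal.ofReal (1 / 20 * volume.real B))
    (by simpa using hμr)
  refine ⟨η, hη, fun p e v hv ha hE => ?_⟩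
  have hvi : IntegrableOn v B := hv.integrableOn hq
  have h1 : ENNReal.ofReal (∫ x in B, max (v x) 0) ≤ ENNReal.ofReal (1 / 20 * volume.real B) := by
    calc ENNReal.ofReal (∫ x in B, max (v x) 0) ≤ ENNReal.ofReal (∫ x in B, ‖v x‖) := by
          refine ENNReal.ofReal_le_ofReal (integral_mono_of_nonneg
            (Eventually.of_forall fun x => le_max_right _ _) hvi.norm
            (Eventually.of_forall fun x => max_le (le_abs_self _) (abs_nonneg _)))
      _ = eLpNorm v 1 (volume.restrict B) := by
          rw [ofReal_integral_norm_eq_lintegral_enorm hvi, eLpNorm_one_eq_lintegral_enorm]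
      _ ≤ eLpNorm v (ENNReal.ofReal 2) (volume.restrict B) * M := by
          have h2 := eLpNorm_le_eLpNorm_mul_rpow_measure_univ (p := 1) (q := ENNReal.ofReal 2)
            (by simp) hvi.aestronglyMeasurable
          refine h2.trans (le_of_eq ?_)
          rw [Measure.restrict_apply_univ]
          congr 2
          norm_num
      _ ≤ C * (energy B θ v ^ (1 / 2 : ℝ) + energy B θ v) * M := by
          gcongr
          exact h hq hv ha
      _ = C * M * (energy B θ v ^ (1 / 2 : ℝ) + energy B θ v) := by ring
      _ ≤ _ := (hlt _ hE).le
  exact (ENNReal.ofReal_le_ofReal_iff (by positivity)).1 h1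

/-- For large `p` an antisymmetric admissible function of small energy has at least `4/3` times the
minimal energy. -/
theorem exists_forall_lam_le {R θ q : ℝ} (hR : 0 < R) (hθ : 0 ≤ 2 * θ) (hθ' : 2 * θ ≤ 1)
    (hq : 1 ≤ q) :
    ∃ η : ℝ≥0∞, η ≠ 0 ∧ ∃ p₁ : ℝ, ∀ p, p₁ < p → ∀ (e : Plane) (v : Plane → ℝ),
      Admissible (Metric.ball 0 R) q p v → IsAntisymmetric (Metric.ball 0 R) e v →
      energy (Metric.ball 0 R) θ v ≤ η →
      lam (Metric.ball 0 R) θ q p ≤ ENNReal.ofReal (3 / 4) * energy (Metric.ball 0 R) θ v := by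
  obtain ⟨η, hη, hmean⟩ := exists_forall_mean_posPart_le (θ := θ) hR hθ' hq
  have hμt : volume (Metric.ball (0 : Plane) R) ≠ ⊤ := measure_ball_lt_top.ne
  have hμ0 : volume (Metric.ball (0 : Plane) R) ≠ 0 := (Metric.measure_ball_pos volume 0 hR).ne'
  have hμr : 0 < volume.real (Metric.ball (0 : Plane) R) := ENNReal.toReal_pos hμ0 hμt
  have hev1 := (ENNReal.tendsto_rpow_one_div_atTop (a := 1 / 2) (by simp) (by simp)).eventually
    (lt_mem_nhds (show ENNReal.ofReal (98 / 100) < 1 by rw [ENNReal.ofReal_lt_one]; norm_num))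
  have hev2 := (ENNReal.tendsto_rpow_one_div_atTop hμ0 hμt).eventually
    (gt_mem_nhds (show 1 < ENNReal.ofReal (11 / 10) by rw [ENNReal.one_lt_ofReal]; norm_num))
  obtain ⟨p₁, hp₁⟩ := eventually_atTop.1 (hev1.and hev2)
  refine ⟨η, hη, max p₁ 1, fun p hp e v hv ha hE => ?_⟩
  obtain ⟨hp2, hp3⟩ := hp₁ p ((le_max_left _ _).trans hp.le)
  have hI0 : 0 ≤ ∫ x in Metric.ball (0 : Plane) R, max (v x) 0 :=
    integral_nonneg fun x => le_max_right _ _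
  refine ha.lam_le hθ hθ' hq ((le_max_right _ _).trans hp.le) hR hv
    (m := (∫ x in Metric.ball (0 : Plane) R, max (v x) 0) /
      volume.real (Metric.ball (0 : Plane) R)) ?_ (by positivity) ?_ hp2.le hp3.le
  · rw [div_mul_cancel₀ _ hμr.ne']
  · rw [div_le_iff₀ hμr]
    exact hmean p e v hv ha hE

theorem mainTheorem5 (R θ q : ℝ) (hR : 0 < R) (hθ : 0 < 2 * θ) (hθ' : 2 * θ < 1)
    (hq : 2 * (1 - θ) ≤ q) (hq' : q < 2) :
    ∃ p₀ : ℝ, 1 < p₀ ∧ ∀ p : ℝ, p₀ < p →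
      lam (Metric.ball 0 R) θ q p < lamAs (Metric.ball 0 R) θ q p ∧
      ∀ u : Plane → ℝ, IsMinimizer (Metric.ball 0 R) θ q p u →
        ∀ e : Plane, e ≠ 0 → ¬ IsAntisymmetric (Metric.ball 0 R) e u := by
  have hq1 : 1 ≤ q := by linarith
  obtain ⟨η, hη, p₁, hlam⟩ := exists_forall_lam_le hR hθ.le hθ'.le hq1
  obtain ⟨p₂, hsmall⟩ := exists_forall_lamAs_lt (q := q) hR hθ.le hη
  refine ⟨max 2 (max p₁ p₂), lt_of_lt_of_le (by norm_num) (le_max_left _ _), fun p hp => ?_⟩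
  obtain ⟨hp2, hpp₁, hpp₂⟩ : 2 < p ∧ p₁ < p ∧ p₂ < p := by
    simpa only [max_lt_iff] using hp
  replace hlam := hlam p hpp₁
  replace hsmall := hsmall p hpp₂
  obtain ⟨c, hc, hpos⟩ := exists_pos_le_energy_of_isAntisymmetric (p := p) hR hθ'.le hq1 hp2.le
  have hκ : ENNReal.ofReal (3 / 4) < 1 := by rw [ENNReal.ofReal_lt_one]; norm_num
  have hκ0 : ENNReal.ofReal (3 / 4) ≠ 0 := by simp
  have hshrink : ∀ t : ℝ≥0∞, t ≠ 0 → t ≠ ⊤ → ENNReal.ofReal (3 / 4) * t < t := by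
    intro t ht0 ht
    calc ENNReal.ofReal (3 / 4) * t < 1 * t := ENNReal.mul_lt_mul_left ht0 ht hκ
      _ = t := one_mul t
  set Λ := lamAs (Metric.ball 0 R) θ q p with hΛ
  have hΛt : Λ ≠ ⊤ := ne_top_of_lt hsmall
  have hΛ0 : Λ ≠ 0 := by
    refine ne_of_gt (lt_of_lt_of_le (pos_iff_ne_zero.2 hc) (le_sInf ?_))
    rintro E ⟨v, hv, ha, rfl⟩
    exact hpos e₂ v hv ha
  have hstrict : lam (Metric.ball 0 R) θ q p < Λ := by
    have h1 : Λ < min η (Λ / ENNReal.ofReal (3 / 4)) := by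
      refine lt_min hsmall ?_
      rw [ENNReal.lt_div_iff_mul_lt (Or.inl hκ0) (Or.inl ENNReal.ofReal_ne_top), mul_comm]
      exact hshrink Λ hΛ0 hΛt
    obtain ⟨E, ⟨v, hv, ha, rfl⟩, hE⟩ := sInf_lt_iff.1 h1
    refine (hlam e₂ v hv ha (hE.le.trans (min_le_left _ _))).trans_lt ?_
    rw [mul_comm, ← ENNReal.lt_div_iff_mul_lt (Or.inl hκ0) (Or.inl ENNReal.ofReal_ne_top)]
    exact hE.trans_le (min_le_right _ _)
  refine ⟨hstrict, fun u hu e _ ha => ?_⟩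
  -- An antisymmetric minimizer would have at most `3/4` of its own energy, which is positive and
  -- finite.
  have hE : energy (Metric.ball 0 R) θ u < η := hu.2 ▸ hstrict.trans hsmall
  have h1 := hlam e u hu.1 ha hE.le
  rw [← hu.2] at h1
  exact absurd h1 (not_le.2 (hshrink _
    (ne_of_gt ((pos_iff_ne_zero.2 hc).trans_le (hpos e u hu.1 ha))) (ne_top_of_lt hE)))
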